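/- Let $G$ be a discrete group. **Rings.** A *ring* is an associative, not necessarily unital or commutative ring $A$ with an action $\alpha$ of $G$ by ring automorphisms; ring homomorphisms are $G$-equivariant. $A$ is *quadratik* if every element of $A$ is a finite sum of products $ab$ with $a,b\in A$. **Functional modules.** A *right functional $A$-module* is a right $A$-module $\mathcal E$ with a $G$-action $S$ by additive maps with $S_g(\xi a)=S_g(\xi)\alpha_g(a)$, together with a set $\Theta_A(\mathcal E)$ of right $A$-linear maps $\mathcal E\to A$ that is a left $A$-submodule of $\mathrm{Hom}_A(\mathcal E,A)$, where $(a\phi)(\xi)=a\phi(\xi)$, and is invariant under $g(\phi)=\alpha_g\circ\phi\circ S_{g^{-1}}$. An isomorphism $\mathcal E\cong\mathcal F$ of such modules is a pair of $G$-equivariant bijections, a right $A$-linear $X:\mathcal E\to\mathcal F$ and a left $A$-linear $f:\Theta_A(\mathcal E)\to\Theta_A(\mathcal F)$, with $f(\phi)(X(\xi))=\phi(\xi)$. $\mathcal E$ is *cofull* if every element of it is a finite sum of elements $\xi\phi(\eta)$ with $\xi,\eta\in\mathcal E$, $\phi\in\Theta_A(\mathcal E)$. A direct sum $\bigoplus_i\mathcal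 E_i$ has as functionals the maps $(\xi_i)_i\mapsto\sum_i\phi_i(\xi_i)$ with $\phi_i\in\Theta_A(\mathcal E_i)$. A quadratik ring $A$ is a right functional module over itself, $\Theta_A(A)$ consisting of the left multiplications by elements of $A$. **Operators.** $\mathcal K_A(\mathcal E)$ is the ring of finite sums of the operators $\theta_{\eta,\phi}(\xi)=\eta\phi(\xi)$ on $\mathcal E$, where $\eta\in\mathcal E$, $\phi\in\Theta_A(\mathcal E)$, and $\mathcal L_A(\mathcal E)\supseteq\mathcal K_A(\mathcal E)$ is the ring of right $A$-linear $V:\mathcal E\to\mathcal E$ with $\phi\circ V\in\Theta_A(\mathcal E)$ for all $\phi\in\Theta_A(\mathcal E)$; $G$ acts on both by $T\mapsto S_gTS_{g^{-1}}$. **Internal tensor product.** For a right functional $A$-module $\mathcal E$, a right functional $B$-module $\mathcal F$ and a ring homomorphism $\pi:A\to\mathcal L_B(\mathcal F)$, $\mathcal E\otimes_\pi\mathcal F$ is the quotient of $\mathcal E\otimes_{\mathbb Z}\mathcal F$ by the subgroup of those $\sum_i\xi_i\otimes\eta_i$ with $\sum_i\pi(\phi(\xi_i))\eta_i=0$ for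 all $\phi\in\Theta_A(\mathcal E)$. It is a right functional $B$-module with the $B$-action of $\mathcal F$, the diagonal $G$-action, and $\Theta_B(\mathcal E\otimes_\pi\mathcal F)$ the set of finite sums of the functionals $\xi\otimes\eta\mapsto\psi(\pi(\phi(\xi))\eta)$, where $\phi\in\Theta_A(\mathcal E)$, $\psi\in\Theta_B(\mathcal F)$. **Functional Morita equivalence.** Quadratik rings $A$ and $B$ are *functional Morita equivalent* if there are a right functional $B$-module $\mathcal E$, a right functional $A$-module $\mathcal F$ and ring homomorphisms $m:A\to\mathcal K_B(\mathcal E)$, $n:B\to\mathcal K_A(\mathcal F)$ such that $\mathcal E\otimes_n\mathcal F\cong A$ as right functional $A$-modules by an isomorphism that is also left $A$-linear, and $\mathcal F\otimes_m\mathcal E\cong B$ as right functional $B$-modules by an isomorphism that is also left $B$-linear. Here $A$ acts on the left of $\mathcal E\otimes_n\mathcal F$ by $m(a)\otimes1$, and $B$ on the left of $\mathcal F\otimes_m\mathcal E$ by $n(b)\otimes1$. **The category $GK^G$.** Its objects are the quadratik rings (in a fixed universe of sets). A *corner embedding* is a ring homomorphism $e:A\to\mathcal K_A(\mathcal E\oplus\mathbb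 H_A)$, $e(a)(\xi\oplus b\oplus\eta)=0\oplus ab\oplus0$, where $\mathcal E$ is a right functional $A$-module, $\mathbb H_A=A\oplus\bigoplus_{j\in J}A$ for some set $J$ (possibly empty), with $G$-action $\alpha\oplus T$ where $T$ is any $G$-action on the right functional module $\bigoplus_JA$, and $\mathcal E\oplus\mathbb H_A$ is cofull. Ring homomorphisms $f_0,f_1:A\to B$ are *homotopic* if $B\to B\otimes_{\mathbb Z}\mathbb C$, $b\mapsto b\otimes1$, is injective and there is a ring homomorphism $f:A\to B\otimes_{\mathbb Z}C([0,1],\mathbb C)$ ($G$ acting on the factor $B$) whose evaluations at $0$ and $1$ are $a\mapsto f_0(a)\otimes1$ and $a\mapsto f_1(a)\otimes1$. $GK^G$ is the category with abelian groups of morphisms and biadditive composition generated by all ring homomorphisms between quadratik rings, a morphism $e^{-1}:\mathcal K_A(\mathcal E\oplus\mathbb H_A)\to A$ for every corner embedding $e$, and a morphism $\Delta:M\to B$ for every short exact sequence $0\to B\xrightarrow{j}M\xrightarrow{f}A\to0$ of quadratik rings with a ring homomorphism $s:A\to M$ such that $f\circ s=\mathrm{id}_A$, subject to the following relations (composition is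 written from left to right): composition of ring homomorphisms in $GK^G$ is their composition; $\mathrm{id}_A$ is the unit of $A$; $1_{A\oplus B}=p_Ai_A+p_Bi_B$ for the canonical projections and injections; $f_0=f_1$ if $f_0,f_1$ are homotopic; $e$ and $e^{-1}$ are inverse to each other; $1_B=j\Delta$ and $1_M=\Delta j+fs$. **Theorem.** If two quadratik rings $A$ and $B$ are functional Morita equivalent, then $A$ and $B$ are isomorphic in $GK^G$. -/

import Mathlib

open scoped TensorProduct

noncomputable section

namespace GKTheory

universe u v

/-! ## Rings with an action of a discrete group -/

/-- A `G`-ring: an associative ring, neither necessarily unital nor commutative, with an action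
of the discrete group `G` by ring automorphisms.  (As `G` is a group, a monoid homomorphism
into the endomorphisms takes values in the automorphisms.) -/
structure GRing (G : Type v) [Group G] where
  carrier : Type u
  [ring : NonUnitalRing carrier]
  act : G →* AddMonoid.End carrier
  act_mul : ∀ g a b, act g (a * b) = act g a * act g b

instance {G : Type v} [Group G] : CoeSort (GRing.{u} G) (Type u) := ⟨GRing.carrier⟩

attribute [instance] GRing.ring

variable {G : Type v} [Group G]

/-- `A` is quadratik: every element is a finite sum of products. -/
def GRing.Quadratik (A : GRing.{u} G) : Prop :=
  ∀ a : A, a ∈ AddSubgroup.closure {x : A | ∃ b c : A, x = b * c}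

/-- `G`-equivariant ring homomorphisms. -/
structure GRingHom (A B : GRing.{u} G) where
  toHom : A.carrier →ₙ+* B.carrier
  map_act : ∀ g a, toHom (A.act g a) = B.act g (toHom a)

instance (A B : GRing.{u} G) : CoeFun (GRingHom A B) (fun _ => A → B) := ⟨fun f => f.toHom⟩

def GRingHom.id (A : GRing.{u} G) : GRingHom A A where
  toHom := NonUnitalRingHom.id A.carrier
  map_act _ _ := rfl

/-- `f.comp g` is first `g`, then `f`. -/
def GRingHom.comp {A B C : GRing.{u} G} (f : GRingHom B C) (g : GRingHom A B) : GRingHom A C where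
  toHom := f.toHom.comp g.toHom
  map_act h a := by
    change f.toHom (g.toHom _) = _
    rw [g.map_act, f.map_act]; rfl

/-- The direct sum `A ⊕ B` with the diagonal action. -/
abbrev GRing.prod (A B : GRing.{u} G) : GRing.{u} G where
  carrier := A.carrier × B.carrier
  act :=
    { toFun := fun g => AddMonoidHom.prodMap (A.act g) (B.act g)
      map_one' := by rw [map_one, map_one]; rfl
      map_mul' := fun g h => by rw [map_mul, map_mul]; rfl }
  act_mul g a b := Prod.ext (A.act_mul g a.1 b.1) (B.act_mul g a.2 b.2)

def GRing.inl (A B : GRing.{u} G) : GRingHom A (A.prod B) where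
  toHom :=
    { toFun := fun a => (a, 0)
      map_mul' := fun _ _ => Prod.ext rfl (mul_zero 0).symm
      map_zero' := rfl
      map_add' := fun _ _ => Prod.ext rfl (add_zero 0).symm }
  map_act g _ := Prod.ext rfl (map_zero (B.act g)).symm

def GRing.inr (A B : GRing.{u} G) : GRingHom B (A.prod B) where
  toHom :=
    { toFun := fun b => (0, b)
      map_mul' := fun _ _ => Prod.ext (mul_zero 0).symm rfl
      map_zero' := rfl
      map_add' := fun _ _ => Prod.ext (add_zero 0).symm rfl }
  map_act g _ := Prod.ext (map_zero (A.act g)).symm rfl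

def GRing.fst (A B : GRing.{u} G) : GRingHom (A.prod B) A where
  toHom := NonUnitalRingHom.fst A.carrier B.carrier
  map_act _ _ := rfl

def GRing.snd (A B : GRing.{u} G) : GRingHom (A.prod B) B where
  toHom := NonUnitalRingHom.snd A.carrier B.carrier
  map_act _ _ := rfl

/-! ## Functional modules -/

/-- A right functional `A`-module: a right `A`-module with a compatible `G`-action and a
distinguished space `Θ` of right `A`-module homomorphisms to `A`, which is a `G`-invariant left
`A`-submodule.  The module structure is written `rmul a ξ = ξ a`. -/
structure FMod (A : GRing.{u} G) where
  carrier : Type u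
  [group : AddCommGroup carrier]
  rmul : A.carrier →+ AddMonoid.End carrier
  rmul_mul : ∀ a b ξ, rmul (a * b) ξ = rmul b (rmul a ξ)
  act : G →* AddMonoid.End carrier
  act_rmul : ∀ g a ξ, act g (rmul a ξ) = rmul (A.act g a) (act g ξ)
  Θ : AddSubgroup (carrier →+ A.carrier)
  Θ_rmul : ∀ φ ∈ Θ, ∀ a ξ, φ (rmul a ξ) = φ ξ * a
  Θ_left : ∀ φ ∈ Θ, ∀ a, (AddMonoidHom.mulLeft a).comp φ ∈ Θ
  Θ_act : ∀ φ ∈ Θ, ∀ g, (A.act g).comp (φ.comp (act g⁻¹)) ∈ Θ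

instance {A : GRing.{u} G} : CoeSort (FMod A) (Type u) := ⟨FMod.carrier⟩

attribute [instance] FMod.group

theorem GRing.act_inv_act (A : GRing.{u} G) (g : G) (a : A) : A.act g⁻¹ (A.act g a) = a := by
  change (A.act g⁻¹ * A.act g) a = a
  rw [← map_mul, inv_mul_cancel, map_one]; rfl

theorem GRing.act_act_inv (A : GRing.{u} G) (g : G) (a : A) : A.act g (A.act g⁻¹ a) = a := by
  change (A.act g * A.act g⁻¹) a = a
  rw [← map_mul, mul_inv_cancel, map_one]; rfl

namespace FMod

variable {A : GRing.{u} G}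

theorem act_inv_act (E : FMod A) (g : G) (ξ : E) : E.act g⁻¹ (E.act g ξ) = ξ := by
  change (E.act g⁻¹ * E.act g) ξ = ξ
  rw [← map_mul, inv_mul_cancel, map_one]; rfl

theorem act_act_inv (E : FMod A) (g : G) (ξ : E) : E.act g (E.act g⁻¹ ξ) = ξ := by
  change (E.act g * E.act g⁻¹) ξ = ξ
  rw [← map_mul, mul_inv_cancel, map_one]; rfl

/-- The left multiplication of `A` on `Θ(E)`: `(a φ)(ξ) = a φ(ξ)`. -/
def thetaLeft (E : FMod A) (a : A) (φ : E.Θ) : E.Θ :=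
  ⟨(AddMonoidHom.mulLeft a).comp φ.1, E.Θ_left φ.1 φ.2 a⟩

/-- The action of `G` on `Θ(E)`: `g(φ) = α_g ∘ φ ∘ S_{g⁻¹}`. -/
def thetaAct (E : FMod A) (g : G) (φ : E.Θ) : E.Θ :=
  ⟨(A.act g).comp (φ.1.comp (E.act g⁻¹)), E.Θ_act φ.1 φ.2 g⟩

/-- The elementary compact operator `θ_{η,φ}(ξ) = η φ(ξ)`. -/
def theta (E : FMod A) (η : E) (φ : E.Θ) : AddMonoid.End E.carrier where
  toFun ξ := E.rmul (φ.1 ξ) η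
  map_zero' := by rw [map_zero, map_zero]; rfl
  map_add' ξ ζ := by rw [map_add, map_add]; rfl

/-- `T` is a right `A`-module homomorphism. -/
def IsRightLinear (E : FMod A) (T : AddMonoid.End E.carrier) : Prop :=
  ∀ a ξ, T (E.rmul a ξ) = E.rmul a (T ξ)

theorem theta_rightLinear (E : FMod A) (η : E) (φ : E.Θ) : E.IsRightLinear (E.theta η φ) := by
  intro a ξ
  change E.rmul (φ.1 (E.rmul a ξ)) η = E.rmul a (E.rmul (φ.1 ξ) η)
  rw [E.Θ_rmul φ.1 φ.2, E.rmul_mul]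

theorem comp_theta (E : FMod A) {T : AddMonoid.End E.carrier} (hT : E.IsRightLinear T)
    (η : E) (φ : E.Θ) : T * E.theta η φ = E.theta (T η) φ := by
  ext ξ
  exact hT _ _

/-- The additive group of compact operators: finite sums of elementary ones. -/
def compactGroup (E : FMod A) : AddSubgroup (AddMonoid.End E.carrier) :=
  AddSubgroup.closure {T | ∃ η φ, T = E.theta η φ}

theorem compact_induction (E : FMod A) {p : AddMonoid.End E.carrier → Prop}
    (h0 : ∀ η φ, p (E.theta η φ)) (h1 : p 0) (h2 : ∀ S T, p S → p T → p (S + T))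
    (h3 : ∀ S, p S → p (-S)) {T : AddMonoid.End E.carrier} (hT : T ∈ E.compactGroup) : p T := by
  induction hT using AddSubgroup.closure_induction with
  | mem x hx => obtain ⟨η, φ, rfl⟩ := hx; exact h0 η φ
  | zero => exact h1
  | add x y _ _ hx hy => exact h2 x y hx hy
  | neg x _ hx => exact h3 x hx

theorem theta_mem (E : FMod A) (η : E) (φ : E.Θ) : E.theta η φ ∈ E.compactGroup :=
  AddSubgroup.subset_closure ⟨η, φ, rfl⟩

theorem compact_rightLinear (E : FMod A) {T : AddMonoid.End E.carrier}
    (hT : T ∈ E.compactGroup) : E.IsRightLinear T := by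
  refine E.compact_induction (fun η φ => E.theta_rightLinear η φ) (fun a ξ => ?_)
    (fun S T hS hT a ξ => ?_) (fun S hS a ξ => ?_) hT
  · exact (map_zero (E.rmul a)).symm
  · change S _ + T _ = E.rmul a (S ξ + T ξ)
    rw [hS, hT, map_add]
  · change -(S _) = E.rmul a (-(S ξ))
    rw [hS, map_neg]

theorem mul_mem_compact (E : FMod A) {S T : AddMonoid.End E.carrier} (hS : E.IsRightLinear S)
    (hT : T ∈ E.compactGroup) : S * T ∈ E.compactGroup := by
  refine E.compact_induction (p := fun T => S * T ∈ E.compactGroup) (fun η φ => ?_) ?_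
    (fun X Y hX hY => ?_) (fun X hX => ?_) hT
  · rw [E.comp_theta hS]; exact E.theta_mem _ _
  · rw [mul_zero]; exact zero_mem _
  · rw [mul_add]; exact add_mem hX hY
  · rw [mul_neg]; exact neg_mem hX

/-- The conjugation action `Ad(S)` of `G` on the operators on `E`. -/
def conj (E : FMod A) (g : G) : AddMonoid.End (AddMonoid.End E.carrier) where
  toFun T := E.act g * T * E.act g⁻¹
  map_zero' := by rw [mul_zero, zero_mul]
  map_add' S T := by rw [mul_add, add_mul]

theorem conj_one (E : FMod A) (T : AddMonoid.End E.carrier) : E.conj 1 T = T := by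
  change E.act 1 * T * E.act 1⁻¹ = T
  rw [inv_one, map_one, one_mul, mul_one]

theorem conj_mul (E : FMod A) (g h : G) (T : AddMonoid.End E.carrier) :
    E.conj (g * h) T = E.conj g (E.conj h T) := by
  change E.act (g * h) * T * E.act (g * h)⁻¹
    = E.act g * (E.act h * T * E.act h⁻¹) * E.act g⁻¹
  rw [mul_inv_rev, map_mul, map_mul]
  simp only [mul_assoc]

theorem conj_comp (E : FMod A) (g : G) (S T : AddMonoid.End E.carrier) :
    E.conj g (S * T) = E.conj g S * E.conj g T := by
  ext ξ
  change E.act g (S (T (E.act g⁻¹ ξ))) =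
    E.act g (S (E.act g⁻¹ (E.act g (T (E.act g⁻¹ ξ)))))
  rw [E.act_inv_act]

theorem conj_theta (E : FMod A) (g : G) (η : E) (φ : E.Θ) :
    E.conj g (E.theta η φ) = E.theta (E.act g η) (E.thetaAct g φ) := by
  ext ξ
  exact E.act_rmul _ _ _

theorem conj_mem_compact (E : FMod A) (g : G) {T : AddMonoid.End E.carrier}
    (hT : T ∈ E.compactGroup) : E.conj g T ∈ E.compactGroup := by
  refine E.compact_induction (p := fun T => E.conj g T ∈ E.compactGroup) (fun η φ => ?_) ?_
    (fun X Y hX hY => ?_) (fun X hX => ?_) hT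
  · rw [E.conj_theta]; exact E.theta_mem _ _
  · rw [map_zero]; exact zero_mem _
  · rw [map_add]; exact add_mem hX hY
  · rw [map_neg]; exact neg_mem hX

/-- The ring `𝒦_A(E)` of compact operators, as a ring of additive maps under composition. -/
def compactSubring (E : FMod A) : NonUnitalSubring (AddMonoid.End E.carrier) where
  __ := E.compactGroup
  mul_mem' hS hT := E.mul_mem_compact (E.compact_rightLinear hS) hT

/-- The `G`-ring `𝒦_A(E)`. -/
abbrev compactRing (E : FMod A) : GRing.{u} G where
  carrier := E.compactSubring
  act :=
    { toFun := fun g =>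
        { toFun := fun T => ⟨E.conj g T.1, E.conj_mem_compact g T.2⟩
          map_zero' := Subtype.ext (map_zero (E.conj g))
          map_add' := fun S T => Subtype.ext (map_add (E.conj g) S.1 T.1) }
      map_one' := by ext1 T; exact Subtype.ext (E.conj_one T.1)
      map_mul' := fun g h => by ext1 T; exact Subtype.ext (E.conj_mul g h T.1) }
  act_mul g S T := Subtype.ext (E.conj_comp g S.1 T.1)

/-- `V` is an adjointable operator on `E`: right `A`-linear with `φ ∘ V ∈ Θ(E)` for `φ ∈ Θ(E)`. -/
def IsAdjointable (E : FMod A) (V : AddMonoid.End E.carrier) : Prop :=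
  E.IsRightLinear V ∧ ∀ φ ∈ E.Θ, AddMonoidHom.comp φ V ∈ E.Θ

/-- The ring `ℒ_A(E)` of adjointable operators. -/
def adjointableSubring (E : FMod A) : NonUnitalSubring (AddMonoid.End E.carrier) where
  carrier := {V | E.IsAdjointable V}
  zero_mem' := ⟨fun a _ => (map_zero (E.rmul a)).symm, fun φ _ => by
    have : AddMonoidHom.comp φ (0 : AddMonoid.End E.carrier) = 0 := by
      ext ξ; exact map_zero φ
    rw [this]; exact zero_mem _⟩
  add_mem' := fun {S T} hS hT => ⟨fun a ξ => by
      change S _ + T _ = E.rmul a (S ξ + T ξ)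
      rw [hS.1, hT.1, map_add], fun φ hφ => by
      have : AddMonoidHom.comp φ (S + T) = AddMonoidHom.comp φ S + AddMonoidHom.comp φ T := by
        ext ξ; exact map_add φ _ _
      rw [this]; exact add_mem (hS.2 φ hφ) (hT.2 φ hφ)⟩
  neg_mem' := fun {S} hS => ⟨fun a ξ => by
      change -(S _) = E.rmul a (-(S ξ))
      rw [hS.1, map_neg], fun φ hφ => by
      have : AddMonoidHom.comp φ (-S) = -AddMonoidHom.comp φ S := by
        ext ξ; exact map_neg φ _
      rw [this]; exact neg_mem (hS.2 φ hφ)⟩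
  mul_mem' := fun {S T} hS hT => ⟨fun a ξ => by
      change S (T _) = E.rmul a (S (T ξ))
      rw [hT.1, hS.1], fun φ hφ => hT.2 _ (hS.2 φ hφ)⟩

theorem conj_mem_adjointable (E : FMod A) (g : G) {T : AddMonoid.End E.carrier}
    (hT : T ∈ E.adjointableSubring) : E.conj g T ∈ E.adjointableSubring := by
  refine ⟨fun a ξ => ?_, fun φ hφ => ?_⟩
  · change E.act g (T (E.act g⁻¹ (E.rmul a ξ))) = E.rmul a (E.act g (T (E.act g⁻¹ ξ)))
    rw [E.act_rmul, hT.1, E.act_rmul, A.act_act_inv]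
  · have h := E.Θ_act _ (hT.2 _ (E.Θ_act φ hφ g⁻¹)) g
    convert h using 1
    ext ξ
    change φ (E.act g (T (E.act g⁻¹ ξ))) =
      A.act g (A.act g⁻¹ (φ (E.act g⁻¹⁻¹ (T (E.act g⁻¹ ξ)))))
    rw [A.act_act_inv, inv_inv]

/-- The `G`-ring `ℒ_A(E)`. -/
abbrev adjointableRing (E : FMod A) : GRing.{u} G where
  carrier := E.adjointableSubring
  act :=
    { toFun := fun g =>
        { toFun := fun T => ⟨E.conj g T.1, E.conj_mem_adjointable g T.2⟩
          map_zero' := Subtype.ext (map_zero (E.conj g))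
          map_add' := fun S T => Subtype.ext (map_add (E.conj g) S.1 T.1) }
      map_one' := by ext1 T; exact Subtype.ext (E.conj_one T.1)
      map_mul' := fun g h => by ext1 T; exact Subtype.ext (E.conj_mul g h T.1) }
  act_mul g S T := Subtype.ext (E.conj_comp g S.1 T.1)

theorem compact_le_adjointable (E : FMod A) : E.compactSubring ≤ E.adjointableSubring := by
  intro T hT
  refine E.compact_induction (p := fun T => T ∈ E.adjointableSubring) (fun η φ => ?_) (zero_mem _)
    (fun _ _ => add_mem) (fun _ => neg_mem) hT
  refine ⟨E.theta_rightLinear η φ, fun ψ hψ => ?_⟩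
  convert E.Θ_left φ.1 φ.2 (ψ η) using 1
  ext ξ
  exact E.Θ_rmul ψ hψ _ _

/-- The inclusion `𝒦_A(E) ⊆ ℒ_A(E)`. -/
def compactIncl (E : FMod A) : GRingHom E.compactRing E.adjointableRing where
  toHom := NonUnitalSubring.inclusion E.compact_le_adjointable
  map_act _ _ := rfl

/-- `E` is cofull: every element is a finite sum of elements `ξ φ(η)`. -/
def Cofull (E : FMod A) : Prop :=
  ∀ ζ : E, ζ ∈ AddSubgroup.closure {x : E | ∃ (ξ η : E) (φ : E.Θ), x = E.rmul (φ.1 η) ξ}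

theorem compactRing_quadratik (E : FMod A) (hE : E.Cofull) : E.compactRing.Quadratik := by
  rintro ⟨T, hT⟩
  let H : AddSubgroup E.compactRing.carrier :=
    AddSubgroup.closure {x | ∃ b c : E.compactRing, x = b * c}
  have key : ∀ η φ, (⟨E.theta η φ, E.theta_mem η φ⟩ : E.compactRing.carrier) ∈ H := by
    intro η φ
    refine AddSubgroup.closure_induction
      (p := fun η _ => (⟨E.theta η φ, E.theta_mem η φ⟩ : E.compactRing.carrier) ∈ H)
      ?_ ?_ ?_ ?_ (hE η)
    · rintro _ ⟨ξ, ζ, ψ, rfl⟩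
      refine AddSubgroup.subset_closure
        ⟨⟨E.theta ξ ψ, E.theta_mem _ _⟩, ⟨E.theta ζ φ, E.theta_mem _ _⟩, Subtype.ext ?_⟩
      exact (E.comp_theta (E.theta_rightLinear ξ ψ) ζ φ).symm
    · refine (congrArg (· ∈ H) (Subtype.ext ?_)).mpr H.zero_mem
      ext ξ
      exact map_zero (E.rmul _)
    · intro x y _ _ hx hy
      refine (congrArg (· ∈ H) (Subtype.ext ?_)).mpr (H.add_mem hx hy)
      ext ξ
      exact map_add (E.rmul _) _ _
    · intro x _ hx
      refine (congrArg (· ∈ H) (Subtype.ext ?_)).mpr (H.neg_mem hx)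
      ext ξ
      exact map_neg (E.rmul _) _
  have : ∃ h : T ∈ E.compactGroup, (⟨T, h⟩ : E.compactRing.carrier) ∈ H := by
    refine E.compact_induction
      (p := fun T => ∃ h : T ∈ E.compactGroup, (⟨T, h⟩ : E.compactRing.carrier) ∈ H)
      (fun η φ => ⟨E.theta_mem η φ, key η φ⟩) ⟨zero_mem _, H.zero_mem⟩ ?_ ?_ hT
    · rintro S T ⟨hS, hS'⟩ ⟨hT, hT'⟩
      exact ⟨add_mem hS hT, H.add_mem hS' hT'⟩
    · rintro S ⟨hS, hS'⟩
      exact ⟨neg_mem hS, H.neg_mem hS'⟩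
  exact this.2

/-- The direct sum `E ⊕ F` of functional modules; its functionals are the
`ξ ⊕ η ↦ φ(ξ) + ψ(η)`. -/
abbrev prod (E F : FMod A) : FMod A where
  carrier := E.carrier × F.carrier
  rmul :=
    { toFun := fun a => AddMonoidHom.prodMap (E.rmul a) (F.rmul a)
      map_zero' := by rw [map_zero, map_zero]; rfl
      map_add' := fun a b => by rw [map_add, map_add]; rfl }
  rmul_mul a b ξ := Prod.ext (E.rmul_mul a b ξ.1) (F.rmul_mul a b ξ.2)
  act :=
    { toFun := fun g => AddMonoidHom.prodMap (E.act g) (F.act g)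
      map_one' := by rw [map_one, map_one]; rfl
      map_mul' := fun g h => by rw [map_mul, map_mul]; rfl }
  act_rmul g a ξ := Prod.ext (E.act_rmul g a ξ.1) (F.act_rmul g a ξ.2)
  Θ :=
    { carrier := {χ | ∃ φ ∈ E.Θ, ∃ ψ ∈ F.Θ, ∀ ξ, χ ξ = φ ξ.1 + ψ ξ.2}
      zero_mem' := ⟨0, zero_mem _, 0, zero_mem _, fun _ => (add_zero _).symm⟩
      add_mem' := by
        rintro χ χ' ⟨φ, hφ, ψ, hψ, h⟩ ⟨φ', hφ', ψ', hψ', h'⟩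
        refine ⟨φ + φ', add_mem hφ hφ', ψ + ψ', add_mem hψ hψ', fun ξ => ?_⟩
        change χ ξ + χ' ξ = (φ ξ.1 + φ' ξ.1) + (ψ ξ.2 + ψ' ξ.2)
        rw [h, h']; abel
      neg_mem' := by
        rintro χ ⟨φ, hφ, ψ, hψ, h⟩
        refine ⟨-φ, neg_mem hφ, -ψ, neg_mem hψ, fun ξ => ?_⟩
        change -(χ ξ) = -(φ ξ.1) + -(ψ ξ.2)
        rw [h]; abel }
  Θ_rmul := by
    rintro χ ⟨φ, hφ, ψ, hψ, h⟩ a ξ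
    rw [h, h, add_mul, ← E.Θ_rmul φ hφ, ← F.Θ_rmul ψ hψ]; rfl
  Θ_left := by
    rintro χ ⟨φ, hφ, ψ, hψ, h⟩ a
    refine ⟨_, E.Θ_left φ hφ a, _, F.Θ_left ψ hψ a, fun ξ => ?_⟩
    change a * χ ξ = a * φ ξ.1 + a * ψ ξ.2
    rw [h, mul_add]
  Θ_act := by
    rintro χ ⟨φ, hφ, ψ, hψ, h⟩ g
    refine ⟨_, E.Θ_act φ hφ g, _, F.Θ_act ψ hψ g, fun ξ => ?_⟩
    change A.act g (χ _) = A.act g (φ _) + A.act g (ψ _)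
    rw [h, map_add]; rfl

/-- A functional module homomorphism `(X, f)`: `X : E → F` equivariant and right `A`-linear,
`f : Θ(E) → Θ(F)` equivariant and left `A`-linear, with `f(φ)(X(ξ)) = φ(ξ)`. -/
structure Hom (E F : FMod A) where
  X : E.carrier →+ F.carrier
  X_rmul : ∀ a ξ, X (E.rmul a ξ) = F.rmul a (X ξ)
  X_act : ∀ g ξ, X (E.act g ξ) = F.act g (X ξ)
  f : E.Θ →+ F.Θ
  f_left : ∀ a φ, f (E.thetaLeft a φ) = F.thetaLeft a (f φ)
  f_act : ∀ g φ, f (E.thetaAct g φ) = F.thetaAct g (f φ)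
  compat : ∀ φ ξ, (f φ).1 (X ξ) = φ.1 ξ

/-- `(X, f)` is an isomorphism of functional modules. -/
def Hom.IsIso {E F : FMod A} (h : Hom E F) : Prop :=
  Function.Bijective h.X ∧ Function.Bijective h.f

end FMod

/-- The ring `A` as a right functional module over itself, with `Θ_A(A) = A` acting by left
multiplication (the convention for quadratik rings). -/
abbrev GRing.self (A : GRing.{u} G) : FMod A where
  carrier := A.carrier
  rmul := AddMonoidHom.mul.flip
  rmul_mul a b ξ := (mul_assoc ξ a b).symm
  act := A.act
  act_rmul g a ξ := A.act_mul g ξ a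
  Θ := (AddMonoidHom.mul : A.carrier →+ A.carrier →+ A.carrier).range
  Θ_rmul := by
    rintro _ ⟨c, rfl⟩ a ξ
    exact (mul_assoc c ξ a).symm
  Θ_left := by
    rintro _ ⟨c, rfl⟩ a
    exact ⟨a * c, AddMonoidHom.ext fun ξ => mul_assoc a c ξ⟩
  Θ_act := by
    rintro _ ⟨c, rfl⟩ g
    refine ⟨A.act g c, AddMonoidHom.ext fun ξ => ?_⟩
    change A.act g c * ξ = A.act g (c * A.act g⁻¹ ξ)
    rw [A.act_mul, A.act_act_inv]

/-! ## The internal tensor product -/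

/-- The additive map on `M ⊗_ℤ N` given by a biadditive map. -/
def liftZ {M N P : Type*} [AddCommGroup M] [AddCommGroup N] [AddCommGroup P]
    (f : M →+ N →+ P) : M ⊗[ℤ] N →+ P :=
  TensorProduct.liftAddHom f fun r m n => by
    rw [map_zsmul, map_zsmul]; rfl

theorem liftZ_tmul {M N P : Type*} [AddCommGroup M] [AddCommGroup N] [AddCommGroup P]
    (f : M →+ N →+ P) (m : M) (n : N) : liftZ f (m ⊗ₜ n) = f m n := rfl

/-- `S ⊗ T` on `M ⊗_ℤ N`. -/
def mapZ {M N M' N' : Type*} [AddCommGroup M] [AddCommGroup N] [AddCommGroup M'] [AddCommGroup N']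
    (S : M →+ M') (T : N →+ N') : M ⊗[ℤ] N →+ M' ⊗[ℤ] N' :=
  (TensorProduct.map S.toIntLinearMap T.toIntLinearMap).toAddMonoidHom

theorem mapZ_tmul {M N M' N' : Type*} [AddCommGroup M] [AddCommGroup N] [AddCommGroup M']
    [AddCommGroup N'] (S : M →+ M') (T : N →+ N') (m : M) (n : N) :
    mapZ S T (m ⊗ₜ n) = S m ⊗ₜ T n := rfl

theorem tensor_hom_ext {M N P : Type*} [AddCommGroup M] [AddCommGroup N] [AddCommGroup P]
    {f g : M ⊗[ℤ] N →+ P} (h : ∀ m n, f (m ⊗ₜ n) = g (m ⊗ₜ n)) : f = g := by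
  ext z
  induction z using TensorProduct.induction_on with
  | zero => rw [map_zero, map_zero]
  | tmul m n => exact h m n
  | add x y hx hy => rw [map_add, map_add, hx, hy]

namespace FMod

variable {A B : GRing.{u} G} (E : FMod A) (F : FMod B) (π : GRingHom A F.adjointableRing)

/-- `ξ ⊗ η ↦ π(φ(ξ)) η` on `E ⊗_ℤ F`. -/
def preEval (φ : E.carrier →+ A.carrier) : E.carrier ⊗[ℤ] F.carrier →+ F.carrier :=
  liftZ
    { toFun := fun ξ => (π (φ ξ)).1
      map_zero' := by rw [map_zero, map_zero]; rfl
      map_add' := fun ξ ζ => by rw [map_add, map_add]; rfl }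

/-- The elements `∑ ξ_i ⊗ η_i` with `∑ π(φ(ξ_i)) η_i = 0` for all `φ ∈ Θ(E)`. -/
def tensorKer : AddSubgroup (E.carrier ⊗[ℤ] F.carrier) where
  carrier := {z | ∀ φ ∈ E.Θ, preEval E F π φ z = 0}
  zero_mem' _ _ := map_zero _
  add_mem' hx hy φ hφ := by rw [map_add, hx φ hφ, hy φ hφ, add_zero]
  neg_mem' hx φ hφ := by rw [map_neg, hx φ hφ, neg_zero]

/-- The underlying abelian group of `E ⊗_π F`. -/
abbrev TensorCarrier : Type u := (E.carrier ⊗[ℤ] F.carrier) ⧸ tensorKer E F π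

/-- The class of `ξ ⊗ η` in `E ⊗_π F`. -/
def tmk (ξ : E) (η : F) : TensorCarrier E F π := QuotientAddGroup.mk (ξ ⊗ₜ η)

theorem tensorCarrier_hom_ext {P : Type*} [AddCommGroup P] {f g : TensorCarrier E F π →+ P}
    (h : ∀ ξ η, f (tmk E F π ξ η) = g (tmk E F π ξ η)) : f = g :=
  QuotientAddGroup.addMonoidHom_ext _ (tensor_hom_ext h)

/-- `ξ ⊗ η ↦ π(φ(ξ)) η` on `E ⊗_π F`, for `φ ∈ Θ(E)`. -/
def tensorEval (φ : E.Θ) : TensorCarrier E F π →+ F.carrier :=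
  QuotientAddGroup.lift _ (preEval E F π φ.1) fun _ hz => hz φ.1 φ.2

/-- The elementary functional `(φ ⊗ ψ)(ξ ⊗ η) = ψ(π(φ(ξ)) η)`. -/
def tensorFunctional (φ : E.Θ) (ψ : F.Θ) : TensorCarrier E F π →+ B.carrier :=
  ψ.1.comp (tensorEval E F π φ)

/-- `1 ⊗ T_b` on `E ⊗_π F`, where `T_b η = η b`. -/
def tensorRmul (b : B) : AddMonoid.End (TensorCarrier E F π) :=
  QuotientAddGroup.map _ _ (mapZ (AddMonoidHom.id _) (F.rmul b)) <| by
    intro z hz φ hφ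
    have : (preEval E F π φ).comp (mapZ (AddMonoidHom.id _) (F.rmul b))
        = AddMonoidHom.comp (F.rmul b) (preEval E F π φ) :=
      tensor_hom_ext fun ξ η => (π (φ ξ)).2.1 b η
    refine (DFunLike.congr_fun this z).trans ?_
    change F.rmul b (preEval E F π φ z) = 0
    rw [hz φ hφ, map_zero]

/-- The diagonal action `S_g ⊗ T_g` on `E ⊗_π F`. -/
def tensorAct (g : G) : AddMonoid.End (TensorCarrier E F π) :=
  QuotientAddGroup.map _ _ (mapZ (E.act g) (F.act g)) <| by
    intro z hz φ hφ
    have : (preEval E F π φ).comp (mapZ (E.act g) (F.act g))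
        = AddMonoidHom.comp (F.act g)
          (preEval E F π ((A.act g⁻¹).comp (φ.comp (E.act g⁻¹⁻¹)))) :=
      tensor_hom_ext fun ξ η => by
        change (π (φ (E.act g ξ))).1 (F.act g η)
          = F.act g ((π (A.act g⁻¹ (φ (E.act g⁻¹⁻¹ ξ)))).1 η)
        rw [π.map_act, inv_inv]
        change _ = F.act g (F.act g⁻¹ ((π (φ (E.act g ξ))).1 (F.act g⁻¹⁻¹ η)))
        rw [F.act_act_inv, inv_inv]
    refine (DFunLike.congr_fun this z).trans ?_
    change F.act g (preEval E F π _ z) = 0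
    rw [hz _ (E.Θ_act φ hφ g⁻¹), map_zero]

/-- `V ⊗ 1` on `E ⊗_π F`, for an adjointable operator `V` on `E`. -/
def tensorLeft (V : E.adjointableRing) : AddMonoid.End (TensorCarrier E F π) :=
  QuotientAddGroup.map _ _ (mapZ V.1 (AddMonoidHom.id _)) <| by
    intro z hz φ hφ
    have : (preEval E F π φ).comp (mapZ V.1 (AddMonoidHom.id _))
        = preEval E F π (φ.comp V.1) :=
      tensor_hom_ext fun ξ η => rfl
    exact (DFunLike.congr_fun this z).trans (hz _ (V.2.2 φ hφ))

/-- The internal tensor product `E ⊗_π F`, a right functional `B`-module. -/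
abbrev tensor : FMod B where
  carrier := TensorCarrier E F π
  rmul :=
    { toFun := tensorRmul E F π
      map_zero' := tensorCarrier_hom_ext E F π fun ξ η => by
        change tmk E F π ξ (F.rmul 0 η) = 0
        rw [map_zero]
        change tmk E F π ξ 0 = 0
        rw [tmk, TensorProduct.tmul_zero]; rfl
      map_add' := fun a b => tensorCarrier_hom_ext E F π fun ξ η => by
        change tmk E F π ξ (F.rmul (a + b) η) = tmk E F π ξ (F.rmul a η) + tmk E F π ξ (F.rmul b η)
        rw [map_add]
        change tmk E F π ξ (F.rmul a η + F.rmul b η) = _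
        rw [tmk, TensorProduct.tmul_add]; rfl }
  rmul_mul a b z := by
    have : tensorRmul E F π (a * b) = AddMonoidHom.comp (tensorRmul E F π b) (tensorRmul E F π a) :=
      tensorCarrier_hom_ext E F π fun ξ η => by
        change tmk E F π ξ (F.rmul (a * b) η) = tmk E F π ξ (F.rmul b (F.rmul a η))
        rw [F.rmul_mul]
    exact DFunLike.congr_fun this z
  act :=
    { toFun := tensorAct E F π
      map_one' := tensorCarrier_hom_ext E F π fun ξ η => by
        change tmk E F π (E.act 1 ξ) (F.act 1 η) = tmk E F π ξ η
        rw [map_one, map_one]; rfl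
      map_mul' := fun g h => tensorCarrier_hom_ext E F π fun ξ η => by
        change tmk E F π (E.act (g * h) ξ) (F.act (g * h) η)
          = tmk E F π (E.act g (E.act h ξ)) (F.act g (F.act h η))
        rw [map_mul, map_mul]; rfl }
  act_rmul g b z := by
    have : AddMonoidHom.comp (tensorAct E F π g) (tensorRmul E F π b)
        = AddMonoidHom.comp (tensorRmul E F π (B.act g b)) (tensorAct E F π g) :=
      tensorCarrier_hom_ext E F π fun ξ η => by
        change tmk E F π (E.act g ξ) (F.act g (F.rmul b η))
          = tmk E F π (E.act g ξ) (F.rmul (B.act g b) (F.act g η))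
        rw [F.act_rmul]
    exact DFunLike.congr_fun this z
  Θ := AddSubgroup.closure {χ | ∃ φ ψ, χ = tensorFunctional E F π φ ψ}
  Θ_rmul χ hχ b z := by
    have : χ.comp (tensorRmul E F π b) = (AddMonoidHom.mulRight b).comp χ := by
      induction hχ using AddSubgroup.closure_induction with
      | mem χ h =>
        obtain ⟨φ, ψ, rfl⟩ := h
        refine tensorCarrier_hom_ext E F π fun ξ η => ?_
        change ψ.1 ((π (φ.1 ξ)).1 (F.rmul b η)) = ψ.1 ((π (φ.1 ξ)).1 η) * b
        rw [(π (φ.1 ξ)).2.1, F.Θ_rmul ψ.1 ψ.2]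
      | zero => exact AddMonoidHom.ext fun z => (zero_mul b).symm
      | add x y _ _ hx hy =>
        refine AddMonoidHom.ext fun z => ?_
        change x (tensorRmul E F π b z) + y (tensorRmul E F π b z) = (x z + y z) * b
        rw [add_mul]
        exact congrArg₂ (· + ·) (DFunLike.congr_fun hx z) (DFunLike.congr_fun hy z)
      | neg x _ hx =>
        refine AddMonoidHom.ext fun z => ?_
        change -(x (tensorRmul E F π b z)) = -(x z) * b
        rw [neg_mul]
        exact congrArg Neg.neg (DFunLike.congr_fun hx z)
    exact DFunLike.congr_fun this z
  Θ_left χ hχ b := by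
    induction hχ using AddSubgroup.closure_induction with
    | mem χ h =>
      obtain ⟨φ, ψ, rfl⟩ := h
      exact AddSubgroup.subset_closure ⟨φ, F.thetaLeft b ψ, rfl⟩
    | zero =>
      rw [show (AddMonoidHom.mulLeft b).comp (0 : TensorCarrier E F π →+ B.carrier) = 0 from
        AddMonoidHom.ext fun z => mul_zero b]
      exact AddSubgroup.zero_mem _
    | add x y _ _ hx hy => rw [AddMonoidHom.comp_add]; exact add_mem hx hy
    | neg x _ hx =>
      rw [show (AddMonoidHom.mulLeft b).comp (-x) = -(AddMonoidHom.mulLeft b).comp x from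
        AddMonoidHom.ext fun z => mul_neg b _]
      exact AddSubgroup.neg_mem _ hx
  Θ_act χ hχ g := by
    change (B.act g).comp (χ.comp (tensorAct E F π g⁻¹)) ∈ _
    induction hχ using AddSubgroup.closure_induction with
    | mem χ h =>
      obtain ⟨φ, ψ, rfl⟩ := h
      refine AddSubgroup.subset_closure ⟨E.thetaAct g φ, F.thetaAct g ψ, ?_⟩
      refine tensorCarrier_hom_ext E F π fun ξ η => ?_
      change B.act g (ψ.1 ((π (φ.1 (E.act g⁻¹ ξ))).1 (F.act g⁻¹ η)))
        = B.act g (ψ.1 (F.act g⁻¹ ((π (A.act g (φ.1 (E.act g⁻¹ ξ)))).1 η)))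
      rw [π.map_act]
      change _ = B.act g (ψ.1 (F.act g⁻¹
        (F.act g ((π (φ.1 (E.act g⁻¹ ξ))).1 (F.act g⁻¹ η)))))
      rw [F.act_inv_act]
    | zero =>
      exact (congrArg (· ∈ AddSubgroup.closure _)
        (AddMonoidHom.ext fun z => map_zero (B.act g))).mpr (AddSubgroup.zero_mem _)
    | add x y _ _ hx hy =>
      exact (congrArg (· ∈ AddSubgroup.closure _)
        (AddMonoidHom.ext fun z => map_add (B.act g) _ _)).mpr (AddSubgroup.add_mem _ hx hy)
    | neg x _ hx =>
      exact (congrArg (· ∈ AddSubgroup.closure _)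
        (AddMonoidHom.ext fun z => map_neg (B.act g) _)).mpr (AddSubgroup.neg_mem _ hx)

end FMod

/-! ## Functional Morita equivalence -/

/-- Let `m : A → 𝒦_B(E)` and `n : B → 𝒦_A(F)` be equivariant ring homomorphisms.
`E ⊗_n F ≅ A` as right functional, left ordinary `A,A`-bimodules, where `A` acts on the left of
`E ⊗_n F` by `m(a) ⊗ 1` and on the left of `A` by multiplication. -/
def TensorIsoSelf {A B : GRing.{u} G} (E : FMod B) (F : FMod A)
    (m : GRingHom A E.compactRing) (n : GRingHom B F.compactRing) : Prop :=
  ∃ h : FMod.Hom (E.tensor F (F.compactIncl.comp n)) A.self, h.IsIso ∧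
    ∀ (a : A) (z : FMod.TensorCarrier E F (F.compactIncl.comp n)),
      h.X (FMod.tensorLeft E F (F.compactIncl.comp n) (E.compactIncl (m a)) z)
        = (a * h.X z : A.carrier)

/-- Functional Morita equivalence of `G`-rings. -/
def FunctionalMoritaEquivalent (A B : GRing.{u} G) : Prop :=
  ∃ (E : FMod B) (F : FMod A) (m : GRingHom A E.compactRing) (n : GRingHom B F.compactRing),
    TensorIsoSelf E F m n ∧ TensorIsoSelf F E n m

/-! ## Corner embeddings -/

/-- A `G`-action on the right functional module `⨁_{j ∈ J} A`, not necessarily a direct sum of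
actions.  The functionals of `⨁_J A` are the maps `x ↦ ∑ j, c j * x j` with `c : J → A`. -/
structure CopiesAction (A : GRing.{u} G) (J : Type u) where
  act : G →* AddMonoid.End (J →₀ A.carrier)
  act_rmul : ∀ g a x,
    act g (x.mapRange (· * a) (zero_mul a)) = (act g x).mapRange (· * A.act g a) (zero_mul _)
  act_functional : ∀ g (c : J → A.carrier), ∃ d : J → A.carrier, ∀ x : J →₀ A.carrier,
    A.act g ((act g⁻¹ x).sum fun j a => c j * a) = x.sum fun j a => d j * a

/-- The right functional module `⨁_{j ∈ J} A` with the `G`-action `S`. -/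
abbrev GRing.copies (A : GRing.{u} G) (J : Type u) (S : CopiesAction A J) : FMod A where
  carrier := J →₀ A.carrier
  rmul :=
    { toFun := fun a => Finsupp.mapRange.addMonoidHom (AddMonoidHom.mulRight a)
      map_zero' := by ext1 x; exact Finsupp.ext fun j => mul_zero (x j)
      map_add' := fun a b => by ext1 x; exact Finsupp.ext fun j => mul_add (x j) a b }
  rmul_mul a b x := Finsupp.ext fun j => (mul_assoc (x j) a b).symm
  act := S.act
  act_rmul g a x := S.act_rmul g a x
  Θ :=
    { carrier := {φ | ∃ c : J → A.carrier, ∀ x : J →₀ A.carrier, φ x = x.sum fun j a => c j * a}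
      zero_mem' := ⟨0, fun x => by
        symm
        exact Finset.sum_eq_zero fun j _ => zero_mul _⟩
      add_mem' := by
        rintro φ ψ ⟨c, hc⟩ ⟨d, hd⟩
        refine ⟨c + d, fun x => ?_⟩
        change φ x + ψ x = _
        rw [hc, hd, ← Finsupp.sum_add]
        exact Finsupp.sum_congr fun j _ => (add_mul _ _ _).symm
      neg_mem' := by
        rintro φ ⟨c, hc⟩
        refine ⟨-c, fun x => ?_⟩
        change -(φ x) = _
        rw [hc, ← Finsupp.sum_neg]
        exact Finsupp.sum_congr fun j _ => (neg_mul _ _).symm }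
  Θ_rmul := by
    rintro φ ⟨c, hc⟩ a x
    rw [hc, hc]
    change (x.mapRange (· * a) (zero_mul a)).sum _ = _
    rw [Finsupp.sum_mapRange_index (fun j => mul_zero _), Finsupp.sum_mul]
    exact Finsupp.sum_congr fun j _ => (mul_assoc _ _ _).symm
  Θ_left := by
    rintro φ ⟨c, hc⟩ a
    refine ⟨fun j => a * c j, fun x => ?_⟩
    change a * φ x = _
    rw [hc, Finsupp.mul_sum]
    exact Finsupp.sum_congr fun j _ => (mul_assoc _ _ _).symm
  Θ_act := by
    rintro φ ⟨c, hc⟩ g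
    obtain ⟨d, hd⟩ := S.act_functional g c
    refine ⟨d, fun x => ?_⟩
    rw [← hd, ← hc]; rfl

/-- `E ⊕ ℍ_A`, where `ℍ_A = A ⊕ ⨁_{j ∈ J} A` carries the action `α ⊕ S`; the first summand `A`
of `ℍ_A` is the distinguished coordinate, and `J` is the set of the remaining indices. -/
abbrev cornerModule {A : GRing.{u} G} (E : FMod A) (J : Type u) (S : CopiesAction A J) : FMod A :=
  E.prod (A.self.prod (A.copies J S))

/-- The operator `ξ ⊕ b ⊕ η ↦ 0 ⊕ a b ⊕ 0` on `E ⊕ ℍ_A`. -/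
def cornerOp {A : GRing.{u} G} (E : FMod A) (J : Type u) (S : CopiesAction A J) (a : A) :
    AddMonoid.End (cornerModule E J S).carrier where
  toFun x := ((0 : E.carrier), (a * x.2.1 : A.carrier), (0 : J →₀ A.carrier))
  map_zero' := Prod.ext rfl (Prod.ext (map_zero (AddMonoidHom.mulLeft a)) rfl)
  map_add' x y := Prod.ext (add_zero _).symm
    (Prod.ext (map_add (AddMonoidHom.mulLeft a) x.2.1 y.2.1) (add_zero _).symm)

theorem cornerOp_zero {A : GRing.{u} G} (E : FMod A) (J : Type u) (S : CopiesAction A J) :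
    cornerOp E J S 0 = 0 := by
  ext1 x
  exact Prod.ext rfl (Prod.ext (zero_mul (show A.carrier from x.2.1)) rfl)

theorem cornerOp_add {A : GRing.{u} G} (E : FMod A) (J : Type u) (S : CopiesAction A J)
    (a b : A) : cornerOp E J S (a + b) = cornerOp E J S a + cornerOp E J S b := by
  ext1 x
  exact Prod.ext (add_zero _).symm (Prod.ext (add_mul a b (show A.carrier from x.2.1)) (add_zero _).symm)

theorem cornerOp_neg {A : GRing.{u} G} (E : FMod A) (J : Type u) (S : CopiesAction A J)
    (a : A) : cornerOp E J S (-a) = -cornerOp E J S a := by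
  ext1 x
  exact Prod.ext neg_zero.symm (Prod.ext (neg_mul a (show A.carrier from x.2.1)) neg_zero.symm)

theorem cornerOp_mul {A : GRing.{u} G} (E : FMod A) (J : Type u) (S : CopiesAction A J)
    (a b : A) : cornerOp E J S (a * b) = cornerOp E J S a * cornerOp E J S b := by
  ext1 x
  exact Prod.ext rfl (Prod.ext (mul_assoc a b (show A.carrier from x.2.1)) rfl)

theorem cornerOp_mem {A : GRing.{u} G} (hA : A.Quadratik) (E : FMod A) (J : Type u)
    (S : CopiesAction A J) (a : A) : cornerOp E J S a ∈ (cornerModule E J S).compactSubring := by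
  refine AddSubgroup.closure_induction
    (p := fun a _ => cornerOp E J S a ∈ (cornerModule E J S).compactSubring) ?_ ?_ ?_ ?_ (hA a)
  · rintro _ ⟨b, c, rfl⟩
    let φ : (cornerModule E J S).Θ :=
      ⟨(AddMonoidHom.mulLeft c).comp
          ((AddMonoidHom.fst A.carrier (J →₀ A.carrier)).comp
            (AddMonoidHom.snd E.carrier (A.carrier × (J →₀ A.carrier)))),
        0, zero_mem _,
        (AddMonoidHom.mulLeft c).comp (AddMonoidHom.fst A.carrier (J →₀ A.carrier)),
        ⟨AddMonoidHom.mulLeft c, ⟨c, rfl⟩, 0, zero_mem _, fun ξ => (add_zero _).symm⟩,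
        fun ξ => (zero_add _).symm⟩
    refine (congrArg (· ∈ (cornerModule E J S).compactSubring) (AddMonoidHom.ext fun x => ?_)).mpr
      ((cornerModule E J S).theta_mem ((0 : E.carrier), b, (0 : J →₀ A.carrier)) φ)
    refine Prod.ext (map_zero (E.rmul _)).symm (Prod.ext (mul_assoc b c (show A.carrier from x.2.1)) ?_)
    exact (map_zero ((A.copies J S).rmul _)).symm
  · rw [cornerOp_zero]; exact zero_mem _
  · intro x y _ _ hx hy
    rw [cornerOp_add]; exact add_mem hx hy
  · intro x _ hx
    rw [cornerOp_neg]; exact neg_mem hx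

/-- The corner embedding `A → 𝒦_A(E ⊕ ℍ_A)`. -/
def cornerEmbedding {A : GRing.{u} G} (hA : A.Quadratik) (E : FMod A) (J : Type u)
    (S : CopiesAction A J) : GRingHom A (cornerModule E J S).compactRing where
  toHom :=
    { toFun := fun a => ⟨cornerOp E J S a, cornerOp_mem hA E J S a⟩
      map_mul' := fun a b => Subtype.ext (cornerOp_mul E J S a b)
      map_zero' := Subtype.ext (cornerOp_zero E J S)
      map_add' := fun a b => Subtype.ext (cornerOp_add E J S a b) }
  map_act g a := by
    refine Subtype.ext ?_
    ext1 x
    refine Prod.ext (map_zero (E.act g)).symm (Prod.ext ?_ (map_zero (S.act g)).symm)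
    have h : ∀ b : A.carrier, A.act g a * b = A.act g (a * A.act g⁻¹ b) := fun b => by
      rw [A.act_mul, A.act_act_inv]
    exact h x.2.1

/-! ## Homotopy -/

theorem tensor_add_mul {M N : Type*} [NonUnitalRing M] [NonUnitalRing N] (x y z : M ⊗[ℤ] N) :
    (x + y) * z = x * z + y * z := by
  let _ : NonUnitalRing (M ⊗[ℤ] N) := Algebra.TensorProduct.instNonUnitalRing
  exact add_mul x y z

theorem tensor_mul_add {M N : Type*} [NonUnitalRing M] [NonUnitalRing N] (x y z : M ⊗[ℤ] N) :
    x * (y + z) = x * y + x * z := by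
  let _ : NonUnitalRing (M ⊗[ℤ] N) := Algebra.TensorProduct.instNonUnitalRing
  exact mul_add x y z

theorem tensor_zero_mul {M N : Type*} [NonUnitalRing M] [NonUnitalRing N] (x : M ⊗[ℤ] N) :
    0 * x = 0 := by
  let _ : NonUnitalRing (M ⊗[ℤ] N) := Algebra.TensorProduct.instNonUnitalRing
  exact zero_mul x

theorem tensor_mul_zero {M N : Type*} [NonUnitalRing M] [NonUnitalRing N] (x : M ⊗[ℤ] N) :
    x * 0 = 0 := by
  let _ : NonUnitalRing (M ⊗[ℤ] N) := Algebra.TensorProduct.instNonUnitalRing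
  exact mul_zero x

theorem mapZ_mul {M N : Type*} [NonUnitalRing M] [NonUnitalRing N] (S : M →+ M)
    (hS : ∀ a b, S (a * b) = S a * S b) (x y : M ⊗[ℤ] N) :
    mapZ S (AddMonoidHom.id N) (x * y)
      = mapZ S (AddMonoidHom.id N) x * mapZ S (AddMonoidHom.id N) y := by
  induction x using TensorProduct.induction_on with
  | zero => rw [tensor_zero_mul, map_zero, tensor_zero_mul]
  | add x x' hx hx' => rw [tensor_add_mul, map_add, map_add, hx, hx', tensor_add_mul]
  | tmul b z =>
    induction y using TensorProduct.induction_on with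
    | zero => rw [tensor_mul_zero, map_zero, tensor_mul_zero]
    | add y y' hy hy' => rw [tensor_mul_add, map_add, map_add, hy, hy', tensor_mul_add]
    | tmul c w =>
      rw [Algebra.TensorProduct.tmul_mul_tmul, mapZ_tmul, mapZ_tmul, mapZ_tmul, hS,
        Algebra.TensorProduct.tmul_mul_tmul]
      rfl

/-- `B[0,1] = B ⊗_ℤ C([0,1], ℂ)`, with the action of `G` on the first factor. -/
abbrev GRing.cylinder (B : GRing.{u} G) : GRing.{u} G where
  carrier := B.carrier ⊗[ℤ] C(unitInterval, ℂ)
  act :=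
    { toFun := fun g => mapZ (B.act g) (AddMonoidHom.id _)
      map_one' := tensor_hom_ext fun b z =>
        congrArg (fun T : AddMonoid.End B.carrier => T b ⊗ₜ[ℤ] z) (map_one B.act)
      map_mul' := fun g h => tensor_hom_ext fun b z =>
        congrArg (fun T : AddMonoid.End B.carrier => T b ⊗ₜ[ℤ] z) (map_mul B.act g h) }
  act_mul g x y := mapZ_mul (B.act g) (B.act_mul g) x y

/-- The evaluation map `v_t : B ⊗ C[0,1] → B ⊗ ℂ`. -/
def GRing.evalAt (B : GRing.{u} G) (t : unitInterval) :
    B.carrier ⊗[ℤ] C(unitInterval, ℂ) →+ B.carrier ⊗[ℤ] ℂ :=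
  mapZ (AddMonoidHom.id _)
    { toFun := fun z : C(unitInterval, ℂ) => z t, map_zero' := rfl, map_add' := fun _ _ => rfl }

/-- The canonical map `b ↦ b ⊗ 1` from `B ≅ B ⊗ ℤ` to `B ⊗ ℂ`. -/
def GRing.toComplexification (B : GRing.{u} G) (b : B) : B.carrier ⊗[ℤ] ℂ := b ⊗ₜ (1 : ℂ)

/-- `f₀, f₁ : A → B` are homotopic: `B ≅ B ⊗ ℤ` is a subring of `B ⊗ ℂ`, and there is an
equivariant ring homomorphism `A → B[0,1]` whose values at `0` and `1` lie in this subring and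
are given there by `f₀` and `f₁`. -/
def Homotopic {A B : GRing.{u} G} (f₀ f₁ : GRingHom A B) : Prop :=
  Function.Injective B.toComplexification ∧
  ∃ f : GRingHom A B.cylinder,
    (∀ a, B.evalAt 0 (f a) = B.toComplexification (f₀ a)) ∧
    (∀ a, B.evalAt 1 (f a) = B.toComplexification (f₁ a))

/-! ## The category `GK^G` -/

variable (G) in
/-- The quadratik `G`-rings. -/
structure QRing where
  ring : GRing.{u} G
  quadratik : ring.Quadratik

theorem prod_quadratik {A B : GRing.{u} G} (hA : A.Quadratik) (hB : B.Quadratik) :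
    (A.prod B).Quadratik := by
  have h1 : ∀ a : A, A.inl B a ∈
      AddSubgroup.closure {x : A.prod B | ∃ b c : A.prod B, x = b * c} := by
    intro a
    refine AddSubgroup.closure_induction (p := fun a _ => A.inl B a ∈ _) ?_ ?_ ?_ ?_ (hA a)
    · rintro _ ⟨b, c, rfl⟩
      exact AddSubgroup.subset_closure ⟨A.inl B b, A.inl B c, map_mul (A.inl B).toHom b c⟩
    · rw [map_zero]; exact zero_mem _
    · intro x y _ _ hx hy
      rw [map_add]; exact add_mem hx hy
    · intro x _ hx
      rw [map_neg]; exact neg_mem hx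
  have h2 : ∀ b : B, A.inr B b ∈
      AddSubgroup.closure {x : A.prod B | ∃ b c : A.prod B, x = b * c} := by
    intro a
    refine AddSubgroup.closure_induction (p := fun a _ => A.inr B a ∈ _) ?_ ?_ ?_ ?_ (hB a)
    · rintro _ ⟨b, c, rfl⟩
      exact AddSubgroup.subset_closure ⟨A.inr B b, A.inr B c, map_mul (A.inr B).toHom b c⟩
    · rw [map_zero]; exact zero_mem _
    · intro x y _ _ hx hy
      rw [map_add]; exact add_mem hx hy
    · intro x _ hx
      rw [map_neg]; exact neg_mem hx
  intro x
  refine (congrArg (· ∈ AddSubgroup.closure {x : A.prod B | ∃ b c : A.prod B, x = b * c})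
    (Prod.ext ?_ ?_)).mpr (add_mem (h1 x.1) (h2 x.2))
  · exact (add_zero (show A.carrier from x.1)).symm
  · exact (zero_add (show B.carrier from x.2)).symm

abbrev QRing.prod (A B : QRing.{u} G) : QRing.{u} G := ⟨A.ring.prod B.ring, prod_quadratik A.2 B.2⟩

/-- The object `𝒦_A(E)`, for a cofull module `E`. -/
abbrev QRing.compact {A : GRing.{u} G} (E : FMod A) (hE : E.Cofull) : QRing.{u} G :=
  ⟨E.compactRing, E.compactRing_quadratik hE⟩

/-- An equivariant short split exact sequence `0 → B → M → A → 0`, with maps `j`, `f` and a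
split `s : A → M` of `f`. -/
structure SplitExact (B M A : QRing.{u} G) where
  j : GRingHom B.ring M.ring
  f : GRingHom M.ring A.ring
  s : GRingHom A.ring M.ring
  j_injective : Function.Injective j
  f_surjective : Function.Surjective f
  exact : ∀ x, f x = 0 ↔ ∃ b, j b = x
  split : ∀ a, f (s a) = a

/-- Generators of `GK^G`: ring homomorphisms, formal inverses of corner embeddings, and formal
splits `Δ : M → B` of short split exact sequences. -/
inductive Gen : QRing.{u} G → QRing.{u} G → Type (max (u + 1) v)
  | hom {A B : QRing.{u} G} (f : GRingHom A.ring B.ring) : Gen A B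
  | cornerInv (A : QRing.{u} G) (E : FMod A.ring) (J : Type u) (S : CopiesAction A.ring J)
      (h : (cornerModule E J S).Cofull) : Gen (QRing.compact _ h) A
  | split {B M A : QRing.{u} G} (σ : SplitExact B M A) : Gen M B

/-- Formal expressions in the generators: composites, sums and negatives.  Composites are
written from left to right. -/
inductive Expr : QRing.{u} G → QRing.{u} G → Type (max (u + 1) v)
  | gen {A B : QRing.{u} G} (x : Gen A B) : Expr A B
  | comp {A B C : QRing.{u} G} (x : Expr A B) (y : Expr B C) : Expr A C
  | zero {A B : QRing.{u} G} : Expr A B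
  | add {A B : QRing.{u} G} (x y : Expr A B) : Expr A B
  | neg {A B : QRing.{u} G} (x : Expr A B) : Expr A B

/-- The expression given by a ring homomorphism. -/
abbrev Expr.hom {A B : QRing.{u} G} (f : GRingHom A.ring B.ring) : Expr A B := .gen (.hom f)

/-- The expression given by the identity of `A`. -/
abbrev Expr.one (A : QRing.{u} G) : Expr A A := .hom (GRingHom.id A.ring)

/-- The congruence on expressions that defines `GK^G`. -/
inductive Rel : ∀ {A B : QRing.{u} G}, Expr A B → Expr A B → Prop
  -- congruence
  | refl {A B : QRing.{u} G} (x : Expr A B) : Rel x x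
  | symm {A B : QRing.{u} G} {x y : Expr A B} : Rel x y → Rel y x
  | trans {A B : QRing.{u} G} {x y z : Expr A B} : Rel x y → Rel y z → Rel x z
  | comp {A B C : QRing.{u} G} {x x' : Expr A B} {y y' : Expr B C} :
      Rel x x' → Rel y y' → Rel (x.comp y) (x'.comp y')
  | add {A B : QRing.{u} G} {x x' y y' : Expr A B} :
      Rel x x' → Rel y y' → Rel (x.add y) (x'.add y')
  | neg {A B : QRing.{u} G} {x x' : Expr A B} : Rel x x' → Rel x.neg x'.neg
  -- category with abelian groups of morphisms and biadditive composition
  | comp_assoc {A B C D : QRing.{u} G} (x : Expr A B) (y : Expr B C) (z : Expr C D) :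
      Rel ((x.comp y).comp z) (x.comp (y.comp z))
  | add_assoc {A B : QRing.{u} G} (x y z : Expr A B) :
      Rel ((x.add y).add z) (x.add (y.add z))
  | add_comm {A B : QRing.{u} G} (x y : Expr A B) : Rel (x.add y) (y.add x)
  | add_zero {A B : QRing.{u} G} (x : Expr A B) : Rel (x.add .zero) x
  | add_neg {A B : QRing.{u} G} (x : Expr A B) : Rel (x.add x.neg) .zero
  | comp_add {A B C : QRing.{u} G} (x : Expr A B) (y z : Expr B C) :
      Rel (x.comp (y.add z)) ((x.comp y).add (x.comp z))
  | add_comp {A B C : QRing.{u} G} (x y : Expr A B) (z : Expr B C) :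
      Rel ((x.add y).comp z) ((x.comp z).add (y.comp z))
  -- units
  | one_comp {A B : QRing.{u} G} (x : Expr A B) : Rel ((Expr.one A).comp x) x
  | comp_one {A B : QRing.{u} G} (x : Expr A B) : Rel (x.comp (Expr.one B)) x
  -- composition of ring homomorphisms
  | hom_comp {A B C : QRing.{u} G} (f : GRingHom A.ring B.ring) (g : GRingHom B.ring C.ring) :
      Rel ((Expr.hom f).comp (Expr.hom g)) (Expr.hom (g.comp f))
  -- additive category
  | biproduct (A B : QRing.{u} G) :
      Rel (Expr.one (A.prod B))
        (((Expr.hom (A := A.prod B) (B := A) (A.ring.fst B.ring)).comp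
            (Expr.hom (A := A) (B := A.prod B) (A.ring.inl B.ring))).add
          ((Expr.hom (A := A.prod B) (B := B) (A.ring.snd B.ring)).comp
            (Expr.hom (A := B) (B := A.prod B) (A.ring.inr B.ring))))
  -- homotopy invariance
  | homotopy {A B : QRing.{u} G} {f₀ f₁ : GRingHom A.ring B.ring} (h : Homotopic f₀ f₁) :
      Rel (Expr.hom f₀) (Expr.hom f₁)
  -- stability
  | corner_inv (A : QRing.{u} G) (E : FMod A.ring) (J : Type u) (S : CopiesAction A.ring J)
      (h : (cornerModule E J S).Cofull) :
      Rel ((Expr.hom (B := QRing.compact _ h) (cornerEmbedding A.quadratik E J S)).comp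
        (.gen (.cornerInv A E J S h))) (Expr.one A)
  | inv_corner (A : QRing.{u} G) (E : FMod A.ring) (J : Type u) (S : CopiesAction A.ring J)
      (h : (cornerModule E J S).Cofull) :
      Rel (Expr.comp (.gen (.cornerInv A E J S h))
        (Expr.hom (B := QRing.compact _ h) (cornerEmbedding A.quadratik E J S)))
        (Expr.one (QRing.compact _ h))
  -- split exactness
  | split_left {B M A : QRing.{u} G} (σ : SplitExact B M A) :
      Rel (Expr.one B) ((Expr.hom σ.j).comp (.gen (.split σ)))
  | split_mid {B M A : QRing.{u} G} (σ : SplitExact B M A) :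
      Rel (Expr.one M)
        ((Expr.comp (.gen (.split σ)) (Expr.hom σ.j)).add
          ((Expr.hom σ.f).comp (Expr.hom σ.s)))

instance exprSetoid (A B : QRing.{u} G) : Setoid (Expr A B) :=
  ⟨Rel, Rel.refl, Rel.symm, Rel.trans⟩

variable (G) in
/-- The objects of the category `GK^G`: the quadratik `G`-rings. -/
structure GK where
  ring : QRing.{u} G

/-- The category `GK^G`. -/
instance : CategoryTheory.Category (GK.{u} G) where
  Hom A B := Quotient (exprSetoid A.ring B.ring)
  id A := Quotient.mk _ (Expr.one A.ring)
  comp x y := Quotient.map₂ Expr.comp (fun _ _ h _ _ h' => Rel.comp h h') x y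
  id_comp x := Quotient.inductionOn x fun x => Quotient.sound (Rel.one_comp x)
  comp_id x := Quotient.inductionOn x fun x => Quotient.sound (Rel.comp_one x)
  assoc x y z := Quotient.inductionOn₃ x y z fun x y z => Quotient.sound (Rel.comp_assoc x y z)

end GKTheory

end

open scoped TensorProduct

noncomputable section

namespace GKTheory

universe u v

variable {G : Type v} [Group G]

/-! A bimodule `E` with `m : A → 𝒦_B(E)` should give a morphism `A → B` of `GK^G`. Since `E` itself
need not be cofull, it is replaced by `m(A)E`, and `M = m(A)E ⊕ B` is the module of a corner
embedding `e_B : B → 𝒦_B(M)` with no further copies of `B`. With `i : A → 𝒦_B(M)`, `a ↦ m(a) ⊕ 0`,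
the morphism is `i e_B⁻¹`, composed from left to right. In the same way `F` and `n` give `N = n(B)F
⊕ A`, a homomorphism `j : B → 𝒦_A(N)`, a corner embedding `e_A : A → 𝒦_A(N)`, and the morphism `j
e_A⁻¹ : B → A`.

Tensoring with `F` should turn `M` into `N`: `m(A)E` becomes `E ⊗_n F ≅ A`, and `B` becomes `n(B)F`.
Instead of an isomorphism of modules, the proof uses only the biadditive pairing `(ξ ⊕ b, f) ↦ n(b)f
⊕ X(ξ ⊗ f)`, whose values span `N`. Each compact `T` on `M` determines a unique operator on `N` that
acts as `T ⊗ 1` on these values. The crux is that this operator is again compact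
(`linkingPair_lift`). There the functional part of the isomorphism `E ⊗_n F ≅ A` enters: it makes
the required functionals on `A` left multiplications.

The resulting homomorphism `τ : 𝒦_B(M) → 𝒦_A(N)` interchanges the two corners: `e_B τ = j`, and `i τ
= e_A` because `E ⊗_n F ≅ A` is left `A`-linear. Hence `i e_B⁻¹ j e_A⁻¹ = i e_B⁻¹ e_B τ e_A⁻¹ = i τ
e_A⁻¹ = e_A e_A⁻¹ = 1`. The other composite is the same statement with the roles of `A` and `B`
exchanged. Of the relations of `GK^G`, only functoriality and the invertibility of corner embeddings
are needed. -/

theorem GRingHom.ext {A B : GRing.{u} G} {f g : GRingHom A B} (h : ∀ a, f a = g a) : f = g := by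
  obtain ⟨f, hf⟩ := f
  obtain ⟨g, hg⟩ := g
  obtain rfl : f = g := NonUnitalRingHom.ext h
  rfl

theorem GRing.Quadratik.induction {A : GRing.{u} G} (hA : A.Quadratik) {p : A → Prop}
    (mul : ∀ b c, p (b * c)) (zero : p 0) (add : ∀ x y, p x → p y → p (x + y))
    (neg : ∀ x, p x → p (-x)) (a : A) : p a := by
  refine AddSubgroup.closure_induction (p := fun a _ => p a) ?_ zero
    (fun x y _ _ => add x y) (fun x _ => neg x) (hA a)
  rintro _ ⟨b, c, rfl⟩
  exact mul b c

/-! ### Representations by compact operators and the essential submodule. -/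

namespace FMod

variable {A B : GRing.{u} G}

theorem compact_rmul (E : FMod B) (T : E.compactRing) (b : B) (ξ : E) :
    T.1 (E.rmul b ξ) = E.rmul b (T.1 ξ) :=
  E.compact_rightLinear T.2 b ξ

theorem apply_act (E : FMod B) (m : GRingHom A E.compactRing) (g : G) (a : A) (ξ : E) :
    E.act g ((m a).1 ξ) = (m (A.act g a)).1 (E.act g ξ) := by
  rw [m.map_act]
  change _ = E.act g ((m a).1 (E.act g⁻¹ (E.act g ξ)))
  rw [E.act_inv_act]

theorem apply_mul (E : FMod B) (m : GRingHom A E.compactRing) (a b : A) (ξ : E) :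
    (m (a * b)).1 ξ = (m a).1 ((m b).1 ξ) := by
  have := map_mul m.toHom a b
  rw [this]; rfl

theorem apply_add (E : FMod B) (m : GRingHom A E.compactRing) (a b : A) (ξ : E) :
    (m (a + b)).1 ξ = (m a).1 ξ + (m b).1 ξ := by
  have := map_add m.toHom a b
  rw [this]; rfl

theorem apply_zero (E : FMod B) (m : GRingHom A E.compactRing) (ξ : E) : (m 0).1 ξ = 0 := by
  have := map_zero m.toHom
  rw [this]; rfl

theorem apply_neg (E : FMod B) (m : GRingHom A E.compactRing) (a : A) (ξ : E) :
    (m (-a)).1 ξ = -(m a).1 ξ := by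
  have := map_neg m.toHom a
  rw [this]; rfl

/-- The span of `m(A) E`. -/
def essentialSpan (E : FMod B) (m : GRingHom A E.compactRing) : AddSubgroup E.carrier :=
  AddSubgroup.closure {x | ∃ a ξ, x = (m a).1 ξ}

theorem apply_mem_essentialSpan (E : FMod B) (m : GRingHom A E.compactRing) (a : A) (ξ : E) :
    (m a).1 ξ ∈ E.essentialSpan m :=
  AddSubgroup.subset_closure ⟨a, ξ, rfl⟩

theorem map_mem_essentialSpan (E : FMod B) (m : GRingHom A E.compactRing)
    (T : AddMonoid.End E.carrier) (hT : ∀ a ξ, T ((m a).1 ξ) ∈ E.essentialSpan m)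
    {ξ : E} (hξ : ξ ∈ E.essentialSpan m) : T ξ ∈ E.essentialSpan m := by
  have : E.essentialSpan m ≤ (E.essentialSpan m).comap T :=
    (AddSubgroup.closure_le _).mpr (by rintro _ ⟨a, ξ, rfl⟩; exact hT a ξ)
  exact this hξ

theorem rmul_mem_essentialSpan (E : FMod B) (m : GRingHom A E.compactRing) (b : B)
    {ξ : E} (hξ : ξ ∈ E.essentialSpan m) : E.rmul b ξ ∈ E.essentialSpan m := by
  refine E.map_mem_essentialSpan m (E.rmul b) (fun a ξ => ?_) hξ
  rw [← E.compact_rmul]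
  exact E.apply_mem_essentialSpan m _ _

theorem act_mem_essentialSpan (E : FMod B) (m : GRingHom A E.compactRing) (g : G)
    {ξ : E} (hξ : ξ ∈ E.essentialSpan m) : E.act g ξ ∈ E.essentialSpan m := by
  refine E.map_mem_essentialSpan m (E.act g) (fun a ξ => ?_) hξ
  rw [E.apply_act]
  exact E.apply_mem_essentialSpan m _ _

/-- The submodule spanned by `m(A) E`, with the restrictions of the functionals of `E`. -/
abbrev essential (E : FMod B) (m : GRingHom A E.compactRing) : FMod B where
  carrier := E.essentialSpan m
  rmul :=
    { toFun := fun b =>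
        { toFun := fun ξ => ⟨E.rmul b ξ.1, E.rmul_mem_essentialSpan m b ξ.2⟩
          map_zero' := Subtype.ext (map_zero (E.rmul b))
          map_add' := fun ξ η => Subtype.ext (map_add (E.rmul b) ξ.1 η.1) }
      map_zero' := by
        ext1 ξ
        exact Subtype.ext (DFunLike.congr_fun (map_zero E.rmul) ξ.1)
      map_add' := fun a b => by
        ext1 ξ
        exact Subtype.ext (DFunLike.congr_fun (map_add E.rmul a b) ξ.1) }
  rmul_mul a b ξ := Subtype.ext (E.rmul_mul a b ξ.1)
  act :=
    { toFun := fun g =>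
        { toFun := fun ξ => ⟨E.act g ξ.1, E.act_mem_essentialSpan m g ξ.2⟩
          map_zero' := Subtype.ext (map_zero (E.act g))
          map_add' := fun ξ η => Subtype.ext (map_add (E.act g) ξ.1 η.1) }
      map_one' := by
        ext1 ξ
        exact Subtype.ext (DFunLike.congr_fun (map_one E.act) ξ.1)
      map_mul' := fun g h => by
        ext1 ξ
        exact Subtype.ext (DFunLike.congr_fun (map_mul E.act g h) ξ.1) }
  act_rmul g a ξ := Subtype.ext (E.act_rmul g a ξ.1)
  Θ :=
    { carrier := {χ | ∃ φ ∈ E.Θ, ∀ ξ, χ ξ = φ ξ.1}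
      zero_mem' := ⟨0, zero_mem _, fun _ => rfl⟩
      add_mem' := by
        rintro χ χ' ⟨φ, hφ, h⟩ ⟨φ', hφ', h'⟩
        exact ⟨φ + φ', add_mem hφ hφ', fun ξ => congrArg₂ (· + ·) (h ξ) (h' ξ)⟩
      neg_mem' := by
        rintro χ ⟨φ, hφ, h⟩
        exact ⟨-φ, neg_mem hφ, fun ξ => congrArg Neg.neg (h ξ)⟩ }
  Θ_rmul := by
    rintro χ ⟨φ, hφ, h⟩ a ξ
    rw [h, h, ← E.Θ_rmul φ hφ]; rfl
  Θ_left := by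
    rintro χ ⟨φ, hφ, h⟩ a
    exact ⟨_, E.Θ_left φ hφ a, fun ξ => congrArg (a * ·) (h ξ)⟩
  Θ_act := by
    rintro χ ⟨φ, hφ, h⟩ g
    exact ⟨_, E.Θ_act φ hφ g, fun ξ => congrArg (B.act g) (h _)⟩

/-- The restriction of a functional of `E` to the essential submodule. -/
def restrictΘ (E : FMod B) (m : GRingHom A E.compactRing) (φ : E.Θ) : (E.essential m).Θ :=
  ⟨φ.1.comp (E.essentialSpan m).subtype, φ.1, φ.2, fun _ => rfl⟩

end FMod

/-! ### The linking module and its cofullness. -/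

/-- The unique action on the zero module `⨁_∅ B`. -/
def CopiesAction.empty (B : GRing.{u} G) : CopiesAction B PEmpty.{u + 1} where
  act := 1
  act_rmul _ _ _ := Subsingleton.elim _ _
  act_functional g c := ⟨c, fun x => by
    rw [Subsingleton.elim x 0]
    exact map_zero (B.act g)⟩

namespace FMod

variable {A B : GRing.{u} G}

/-- `m(A) E ⊕ B`, as the module of a corner embedding of `B`. -/
abbrev linking (E : FMod B) (m : GRingHom A E.compactRing) : FMod B :=
  cornerModule (E.essential m) PEmpty.{u + 1} (CopiesAction.empty B)

/-- The inclusion `ξ ↦ ξ ⊕ 0` into `m(A) E ⊕ B`. -/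
def linkingInl (E : FMod B) (m : GRingHom A E.compactRing) :
    E.essentialSpan m →+ (E.linking m).carrier :=
  AddMonoidHom.inl _ _

/-- The inclusion `b ↦ 0 ⊕ b` into `m(A) E ⊕ B`. -/
def linkingInr (E : FMod B) (m : GRingHom A E.compactRing) :
    B.carrier →+ (E.linking m).carrier :=
  (AddMonoidHom.inr _ _).comp (AddMonoidHom.inl _ _)

theorem linking_ext (E : FMod B) (m : GRingHom A E.compactRing) {x y : E.linking m}
    (h1 : x.1.1 = y.1.1) (h2 : x.2.1 = y.2.1) : x = y :=
  Prod.ext (Subtype.ext h1) (Prod.ext h2 (Subsingleton.elim _ _))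

/-- The functional `ξ ⊕ b ↦ φ(ξ) + χ(b)` of `m(A) E ⊕ B`. -/
def linkingΘ (E : FMod B) (m : GRingHom A E.compactRing) (φ : (E.essential m).Θ)
    (χ : B.self.Θ) : (E.linking m).Θ :=
  ⟨φ.1.comp (AddMonoidHom.fst _ _) +
      χ.1.comp ((AddMonoidHom.fst _ _).comp (AddMonoidHom.snd _ _)),
    φ.1, φ.2, χ.1.comp (AddMonoidHom.fst _ _),
    ⟨χ.1, χ.2, 0, zero_mem _, fun _ => (add_zero _).symm⟩, fun _ => rfl⟩

/-- Functionals on `m(A)E` are restrictions from `E` by definition, so a functional of the linking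
module can be described by data that no longer mention the submodule. This gives the pair `(φ, c)`
from which `linkingEval` is built. -/
theorem linking_functional (E : FMod B) (m : GRingHom A E.compactRing) (χ : (E.linking m).Θ) :
    ∃ (φ : E.Θ) (c : B), ∀ x : E.linking m, χ.1 x = φ.1 x.1.1 + c * x.2.1 := by
  obtain ⟨χ, φ, ⟨φ', hφ', hφ⟩, ψ, ⟨_, ⟨c, rfl⟩, ω, hω, hψ⟩, h⟩ := χ
  refine ⟨⟨φ', hφ'⟩, c, fun x => ?_⟩
  change χ x = _
  -- The third summand is indexed by the empty type, so `ω` contributes nothing.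
  rw [h, hψ, hφ, Subsingleton.elim x.2.2 0, map_zero, add_zero]
  rfl

variable (E : FMod B) (m : GRingHom A E.compactRing)

theorem linking_le {H : AddSubgroup (E.linking m).carrier}
    (h1 : ∀ a ξ, E.linkingInl m ⟨(m a).1 ξ, E.apply_mem_essentialSpan m a ξ⟩ ∈ H)
    (h2 : ∀ b, E.linkingInr m b ∈ H) (x : E.linking m) : x ∈ H := by
  -- The span is a subgroup of `E`, so generators are compared inside `E`; injectivity of the
  -- inclusion brings the result back to the linking module.
  have h3 : E.essentialSpan m ≤ (H.comap (E.linkingInl m)).map (E.essentialSpan m).subtype :=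
    (AddSubgroup.closure_le _).mpr (by rintro _ ⟨a, ξ, rfl⟩; exact ⟨_, h1 a ξ, rfl⟩)
  have h4 : E.linkingInl m x.1 ∈ H := by
    obtain ⟨y, hy, hxy⟩ := h3 x.1.2
    rw [← Subtype.ext (a1 := y) (a2 := x.1) hxy]
    exact hy
  have h5 : x = E.linkingInl m x.1 + E.linkingInr m x.2.1 :=
    E.linking_ext m (add_zero _).symm (zero_add _).symm
  rw [h5]
  exact H.add_mem h4 (h2 _)

/-- Triple products suffice. Expanding the compact operator `m(c)` in `m(bcd)ξ = m(b) m(c) (m(d)ξ)`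
into operators `θ_{η,φ}` gives terms `(m(b)η) φ(m(d)ξ)`, where both vectors lie in `m(A)E`. In `B`,
the product `bcd` is `b` times the functional "left multiplication by `c`" at `d`. -/
theorem linking_cofull (hA : A.Quadratik) (hB : B.Quadratik) : (E.linking m).Cofull := by
  let H : AddSubgroup (E.linking m).carrier :=
    AddSubgroup.closure {x | ∃ (ξ η : E.linking m) (φ : (E.linking m).Θ),
      x = (E.linking m).rmul (φ.1 η) ξ}
  change ∀ x, x ∈ H
  -- The vectors of `m(A)E` whose inclusion lies in `H`, regarded in `E`. Induction over compact
  -- operators on `E` can then be run without carrying membership proofs.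
  let K : AddSubgroup E.carrier := (H.comap (E.linkingInl m)).map (E.essentialSpan m).subtype
  have gen : ∀ (a : A) (η ζ : E) (φ : E.Θ), ζ ∈ E.essentialSpan m →
      E.rmul (φ.1 ζ) ((m a).1 η) ∈ K := by
    intro a η ζ φ hζ
    refine ⟨⟨_, E.rmul_mem_essentialSpan m _ (E.apply_mem_essentialSpan m a η)⟩,
      AddSubgroup.subset_closure ⟨E.linkingInl m ⟨_, E.apply_mem_essentialSpan m a η⟩,
        E.linkingInl m ⟨ζ, hζ⟩, E.linkingΘ m (E.restrictΘ m φ) 0, ?_⟩, rfl⟩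
    have : (E.linkingΘ m (E.restrictΘ m φ) 0).1 (E.linkingInl m ⟨ζ, hζ⟩) = φ.1 ζ :=
      add_zero (φ.1 ζ)
    rw [this]
    exact E.linking_ext m rfl (zero_mul (φ.1 ζ)).symm
  have comp : ∀ (a : A) (T : AddMonoid.End E.carrier), T ∈ E.compactGroup →
      ∀ ζ ∈ E.essentialSpan m, (m a).1 (T ζ) ∈ K := by
    intro a T hT ζ hζ
    refine E.compact_induction (p := fun T => (m a).1 (T ζ) ∈ K) (fun η φ => ?_) ?_ ?_ ?_ hT
    · change (m a).1 (E.rmul (φ.1 ζ) η) ∈ K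
      rw [E.compact_rmul]
      exact gen a η ζ φ hζ
    · change (m a).1 0 ∈ K
      rw [map_zero]; exact zero_mem _
    · intro S T hS hT
      change (m a).1 (S ζ + T ζ) ∈ K
      rw [map_add]; exact add_mem hS hT
    · intro S hS
      change (m a).1 (-(S ζ)) ∈ K
      rw [map_neg]; exact neg_mem hS
  have apply_mem : ∀ a ξ, (m a).1 ξ ∈ K := by
    intro a ξ
    -- The second factor is split again: the outer factors put both vectors into `m(A)E`, and the
    -- middle one supplies the functionals.
    refine hA.induction (p := fun a => (m a).1 ξ ∈ K) (fun b c => ?_) ?_ ?_ ?_ a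
    · refine hA.induction (p := fun c => (m (b * c)).1 ξ ∈ K) (fun c d => ?_) ?_ ?_ ?_ c
      · rw [apply_mul, apply_mul]
        exact comp b _ (m c).2 _ (E.apply_mem_essentialSpan m d ξ)
      · rw [mul_zero, apply_zero]; exact zero_mem _
      · intro x y hx hy
        rw [mul_add, apply_add]; exact add_mem hx hy
      · intro x hx
        rw [mul_neg, apply_neg]; exact neg_mem hx
    · rw [apply_zero]; exact zero_mem _
    · intro x y hx hy
      rw [apply_add]; exact add_mem hx hy
    · intro x hx
      rw [apply_neg]; exact neg_mem hx
  refine E.linking_le m (fun a ξ => ?_) fun b => ?_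
  · obtain ⟨y, hy, hxy⟩ := apply_mem a ξ
    rw [← Subtype.ext (a1 := y) (a2 := ⟨_, E.apply_mem_essentialSpan m a ξ⟩) hxy]
    exact hy
  · refine hB.induction (p := fun b => E.linkingInr m b ∈ H) (fun b c => ?_) ?_ ?_ ?_ b
    · refine hB.induction (p := fun c => E.linkingInr m (b * c) ∈ H) (fun c d => ?_) ?_ ?_ ?_ c
      · refine AddSubgroup.subset_closure ⟨E.linkingInr m b, E.linkingInr m d,
          E.linkingΘ m 0 ⟨AddMonoidHom.mulLeft c, c, rfl⟩, ?_⟩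
        have : (E.linkingΘ m 0 ⟨AddMonoidHom.mulLeft c, c, rfl⟩).1 (E.linkingInr m d) = c * d :=
          zero_add (c * d)
        rw [this]
        exact E.linking_ext m (map_zero (E.rmul (c * d))).symm rfl
      · rw [mul_zero, map_zero]; exact zero_mem _
      · intro x y hx hy
        rw [mul_add, map_add]; exact add_mem hx hy
      · intro x hx
        rw [mul_neg, map_neg]; exact neg_mem hx
    · rw [map_zero]; exact zero_mem _
    · intro x y hx hy
      rw [map_add]; exact add_mem hx hy
    · intro x hx
      rw [map_neg]; exact neg_mem hx

/-! ### The homomorphism into the compact operators of the linking module. -/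

/-- The operator `m(a) ⊕ 0` on `m(A) E ⊕ B`. -/
def linkingOp (a : A) : AddMonoid.End (E.linking m).carrier where
  toFun x := E.linkingInl m ⟨(m a).1 x.1.1, E.apply_mem_essentialSpan m a x.1.1⟩
  map_zero' := E.linking_ext m (map_zero (m a).1) rfl
  map_add' x y := E.linking_ext m (map_add (m a).1 x.1.1 y.1.1) (add_zero _).symm

theorem linkingOp_zero : E.linkingOp m 0 = 0 := by
  ext1 x
  exact E.linking_ext m (E.apply_zero m _) rfl

theorem linkingOp_add (a b : A) : E.linkingOp m (a + b) = E.linkingOp m a + E.linkingOp m b := by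
  ext1 x
  exact E.linking_ext m (E.apply_add m a b _) (add_zero _).symm

theorem linkingOp_neg (a : A) : E.linkingOp m (-a) = -E.linkingOp m a := by
  ext1 x
  exact E.linking_ext m (E.apply_neg m a _) neg_zero.symm

theorem linkingOp_mul (a b : A) : E.linkingOp m (a * b) = E.linkingOp m a * E.linkingOp m b := by
  ext1 x
  exact E.linking_ext m (E.apply_mul m a b _) rfl

/-- The vectors `η` in an expansion of `m(a)` into `θ_{η,φ}` need not lie in `m(A)E`, so compactness
does not restrict for free. For a product, `m(b) θ_{η,φ} = θ_{m(b)η,φ}` moves the vector into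
`m(A)E`, and products generate `A`. -/
theorem linkingOp_mem (hA : A.Quadratik) (a : A) :
    E.linkingOp m a ∈ (E.linking m).compactSubring := by
  have comp : ∀ (a : A) (T : AddMonoid.End E.carrier), T ∈ E.compactGroup →
      ∃ S ∈ (E.linking m).compactGroup, ∀ x, S x =
        E.linkingInl m ⟨(m a).1 (T x.1.1), E.apply_mem_essentialSpan m a (T x.1.1)⟩ := by
    intro a T hT
    refine E.compact_induction (p := fun T => ∃ S ∈ (E.linking m).compactGroup, ∀ x, S x =
      E.linkingInl m ⟨(m a).1 (T x.1.1), E.apply_mem_essentialSpan m a (T x.1.1)⟩)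
      (fun η φ => ?_) ?_ ?_ ?_ hT
    · refine ⟨_, (E.linking m).theta_mem
        (E.linkingInl m ⟨_, E.apply_mem_essentialSpan m a η⟩)
        (E.linkingΘ m (E.restrictΘ m φ) 0), fun x => ?_⟩
      have : (E.linkingΘ m (E.restrictΘ m φ) 0).1 x = φ.1 x.1.1 := add_zero (φ.1 x.1.1)
      change (E.linking m).rmul ((E.linkingΘ m (E.restrictΘ m φ) 0).1 x) _ = _
      rw [this]
      exact E.linking_ext m (E.compact_rmul (m a) _ _).symm (zero_mul (φ.1 x.1.1))
    · exact ⟨0, zero_mem _, fun x => E.linking_ext m (map_zero (m a).1).symm rfl⟩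
    · rintro S T ⟨S', hS, hS'⟩ ⟨T', hT, hT'⟩
      refine ⟨S' + T', add_mem hS hT, fun x => ?_⟩
      change S' x + T' x = _
      rw [hS', hT']
      exact E.linking_ext m (map_add (m a).1 _ _).symm (add_zero _)
    · rintro S ⟨S', hS, hS'⟩
      refine ⟨-S', neg_mem hS, fun x => ?_⟩
      change -(S' x) = _
      rw [hS']
      exact E.linking_ext m (map_neg (m a).1 _).symm neg_zero
  refine hA.induction (p := fun a => E.linkingOp m a ∈ (E.linking m).compactSubring)
    (fun b c => ?_) ?_ ?_ ?_ a
  · obtain ⟨S, hS, hS'⟩ := comp b _ (m c).2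
    have : E.linkingOp m (b * c) = S := by
      ext1 x
      rw [hS']
      exact E.linking_ext m (E.apply_mul m b c _) rfl
    rw [this]
    exact hS
  · rw [linkingOp_zero]; exact zero_mem _
  · intro x y hx hy
    rw [linkingOp_add]; exact add_mem hx hy
  · intro x hx
    rw [linkingOp_neg]; exact neg_mem hx

/-- The homomorphism `A → 𝒦_B(m(A) E ⊕ B)`, `a ↦ m(a) ⊕ 0`. -/
def linkingHom (hA : A.Quadratik) : GRingHom A (E.linking m).compactRing where
  toHom :=
    { toFun := fun a => ⟨E.linkingOp m a, E.linkingOp_mem m hA a⟩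
      map_mul' := fun a b => Subtype.ext (E.linkingOp_mul m a b)
      map_zero' := Subtype.ext (E.linkingOp_zero m)
      map_add' := fun a b => Subtype.ext (E.linkingOp_add m a b) }
  map_act g a := by
    refine Subtype.ext ?_
    ext1 x
    refine E.linking_ext m ?_ (map_zero (B.act g)).symm
    change (m (A.act g a)).1 x.1.1 = E.act g ((m a).1 (E.act g⁻¹ x.1.1))
    rw [E.apply_act, E.act_act_inv]

end FMod

/-! ## Transfer of compact operators along a spanning pairing -/

namespace FMod

variable {A B : GRing.{u} G}

/-- A spanning equivariant pairing `M × F → N` along which compact operators transfer. -/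
structure Transfer (M : FMod B) (F : FMod A) (N : FMod A) where
  pair : M.carrier →+ F.carrier →+ N.carrier
  pair_act : ∀ g x f, pair (M.act g x) (F.act g f) = N.act g (pair x f)
  span : ∀ y, y ∈ AddSubgroup.closure {y | ∃ x f, y = pair x f}
  lift : ∀ T ∈ M.compactGroup, ∃ T' ∈ N.compactGroup, ∀ x f, T' (pair x f) = pair (T x) f

namespace Transfer

variable {M : FMod B} {F N : FMod A} (Q : Transfer M F N)

/-- Operators on `N` are determined by the values of the pairing. This makes the transferred
operator unique, hence multiplicative, additive and equivariant in `T`. -/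
theorem hom_ext {S T : AddMonoid.End N.carrier} (h : ∀ x f, S (Q.pair x f) = T (Q.pair x f)) :
    S = T := by
  ext1 y
  refine AddSubgroup.closure_induction (p := fun y _ => S y = T y) ?_ ?_ ?_ ?_ (Q.span y)
  · rintro _ ⟨x, f, rfl⟩
    exact h x f
  · rw [map_zero, map_zero]
  · intro x y _ _ hx hy
    rw [map_add, map_add, hx, hy]
  · intro x _ hx
    rw [map_neg, map_neg, hx]

/-- The choice is harmless, as `hom_ext` leaves only one candidate. -/
def op (T : M.compactRing) : N.compactRing :=
  ⟨(Q.lift T.1 T.2).choose, (Q.lift T.1 T.2).choose_spec.1⟩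

theorem op_pair (T : M.compactRing) (x : M) (f : F) :
    (Q.op T).1 (Q.pair x f) = Q.pair (T.1 x) f :=
  (Q.lift T.1 T.2).choose_spec.2 x f

theorem op_eq {T : M.compactRing} {S : N.compactRing}
    (h : ∀ x f, S.1 (Q.pair x f) = Q.pair (T.1 x) f) : Q.op T = S :=
  Subtype.ext (Q.hom_ext fun x f => (Q.op_pair T x f).trans (h x f).symm)

/-- The homomorphism `𝒦(M) → 𝒦(N)` determined by a transfer. -/
def hom : GRingHom M.compactRing N.compactRing where
  toHom :=
    { toFun := Q.op
      map_mul' := fun S T => Q.op_eq fun x f => by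
        change (Q.op S).1 ((Q.op T).1 (Q.pair x f)) = Q.pair (S.1 (T.1 x)) f
        rw [op_pair, op_pair]
      map_zero' := Q.op_eq fun x f => (DFunLike.congr_fun (map_zero Q.pair) f).symm
      map_add' := fun S T => Q.op_eq fun x f => by
        change (Q.op S).1 (Q.pair x f) + (Q.op T).1 (Q.pair x f) = Q.pair (S.1 x + T.1 x) f
        rw [op_pair, op_pair, map_add]; rfl }
  map_act g T := Q.op_eq fun x f => by
    change N.act g ((Q.op T).1 (N.act g⁻¹ (Q.pair x f))) =
      Q.pair (M.act g (T.1 (M.act g⁻¹ x))) f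
    rw [← Q.pair_act, op_pair, ← Q.pair_act, F.act_act_inv]

end Transfer

end FMod

/-! ## The transfer given by a Morita equivalence -/

namespace FMod

variable {A B : GRing.{u} G} (E : FMod B) (F : FMod A) (m : GRingHom A E.compactRing)
  (n : GRingHom B F.compactRing)

/-- The class of `ξ ⊗ f` in `E ⊗_n F`, as a biadditive map. -/
def tensorMk : E.carrier →+ F.carrier →+ TensorCarrier E F (F.compactIncl.comp n) where
  toFun ξ :=
    { toFun := fun f => tmk E F (F.compactIncl.comp n) ξ f
      map_zero' := by rw [tmk, TensorProduct.tmul_zero]; rfl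
      map_add' := fun f f' => by rw [tmk, TensorProduct.tmul_add]; rfl }
  map_zero' := AddMonoidHom.ext fun f => by
    change tmk E F (F.compactIncl.comp n) 0 f = 0
    rw [tmk, TensorProduct.zero_tmul]; rfl
  map_add' ξ ξ' := AddMonoidHom.ext fun f => by
    change tmk E F (F.compactIncl.comp n) (ξ + ξ') f = _
    rw [tmk, TensorProduct.add_tmul]; rfl

theorem tensorEval_tensorMk (φ : E.Θ) (ξ : E) (f : F) :
    tensorEval E F (F.compactIncl.comp n) φ (tensorMk E F n ξ f) = (n (φ.1 ξ)).1 f := rfl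

/-- The subgroup divided out in `E ⊗_n F` is the common kernel of these evaluations, so they
separate points. -/
theorem tensor_ext {z w : TensorCarrier E F (F.compactIncl.comp n)}
    (h : ∀ φ, tensorEval E F (F.compactIncl.comp n) φ z
      = tensorEval E F (F.compactIncl.comp n) φ w) : z = w := by
  rw [← sub_eq_zero]
  have h' : ∀ φ, tensorEval E F (F.compactIncl.comp n) φ (z - w) = 0 := fun φ => by
    rw [map_sub, h, sub_self]
  revert h'
  generalize z - w = x
  induction x using QuotientAddGroup.induction_on with
  | H x => exact fun h' => (QuotientAddGroup.eq_zero_iff x).mpr fun φ hφ => h' ⟨φ, hφ⟩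

/-- The internal tensor product is formed over `ℤ`, but it is automatically balanced over `B`: each
`φ` is right linear and `n` is multiplicative, so no evaluation sees a difference. -/
theorem tensorMk_rmul (b : B) (ξ : E) (f : F) :
    tensorMk E F n (E.rmul b ξ) f = tensorMk E F n ξ ((n b).1 f) :=
  tensor_ext E F n fun φ => by
    rw [tensorEval_tensorMk, tensorEval_tensorMk, E.Θ_rmul φ.1 φ.2, apply_mul]

theorem tensor_induction {p : TensorCarrier E F (F.compactIncl.comp n) → Prop}
    (mk : ∀ ξ f, p (tensorMk E F n ξ f)) (zero : p 0) (add : ∀ x y, p x → p y → p (x + y))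
    (z) : p z := by
  induction z using QuotientAddGroup.induction_on with
  | H z =>
    induction z using TensorProduct.induction_on with
    | zero => exact zero
    | tmul ξ f => exact mk ξ f
    | add x y hx hy => exact add _ _ hx hy

variable (h : Hom (E.tensor F (F.compactIncl.comp n)) A.self)

/-- The pairing `(ξ ⊕ b, f) ↦ n(b) f ⊕ X(ξ ⊗ f)`. -/
def linkingPair : (E.linking m).carrier →+ F.carrier →+ (F.linking n).carrier where
  toFun x :=
    { toFun := fun f => (⟨(n x.2.1).1 f, F.apply_mem_essentialSpan n x.2.1 f⟩,
        h.X (tensorMk E F n x.1.1 f), 0)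
      map_zero' := F.linking_ext n (map_zero (n x.2.1).1)
        ((congrArg h.X (map_zero (tensorMk E F n x.1.1))).trans (map_zero h.X))
      map_add' := fun f f' => F.linking_ext n (map_add (n x.2.1).1 f f')
        ((congrArg h.X (map_add (tensorMk E F n x.1.1) f f')).trans (map_add h.X _ _)) }
  map_zero' := AddMonoidHom.ext fun f => F.linking_ext n (F.apply_zero n f)
    ((congrArg h.X (DFunLike.congr_fun (map_zero (tensorMk E F n)) f)).trans (map_zero h.X))
  map_add' x y := AddMonoidHom.ext fun f => F.linking_ext n (F.apply_add n x.2.1 y.2.1 f)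
    ((congrArg h.X (DFunLike.congr_fun (map_add (tensorMk E F n) x.1.1 y.1.1) f)).trans
      (map_add h.X _ _))

theorem linkingPair_act (g : G) (x : E.linking m) (f : F) :
    linkingPair E F m n h ((E.linking m).act g x) (F.act g f)
      = (F.linking n).act g (linkingPair E F m n h x f) :=
  F.linking_ext n (F.apply_act n g x.2.1 f).symm (h.X_act g (tensorMk E F n x.1.1 f))

/-- Balancedness over `B`: the pairing behaves as if defined on a tensor product of the linking
module with `F` over `B`. -/
theorem linkingPair_rmul_left (b : B) (x : E.linking m) (f : F) :
    linkingPair E F m n h ((E.linking m).rmul b x) f = linkingPair E F m n h x ((n b).1 f) :=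
  F.linking_ext n (F.apply_mul n x.2.1 b f) (congrArg h.X (tensorMk_rmul E F n b x.1.1 f))

theorem linkingPair_rmul (a : A) (x : E.linking m) (f : F) :
    linkingPair E F m n h x (F.rmul a f) = (F.linking n).rmul a (linkingPair E F m n h x f) :=
  F.linking_ext n (F.compact_rmul (n x.2.1) a f) (h.X_rmul a (tensorMk E F n x.1.1 f))

/-! ### Compactness of the transferred operators. -/

variable (hX : Function.Bijective h.X)

/-- The operator `f ⊕ a ↦ n(c) f + φ(X⁻¹ a)` from `n(B) F ⊕ A` to `F`. -/
def linkingEval (φ : E.Θ) (c : B) : (F.linking n).carrier →+ F.carrier :=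
  AddMonoidHom.comp (n c).1 ((F.essentialSpan n).subtype.comp (AddMonoidHom.fst _ _)) +
    (tensorEval E F (F.compactIncl.comp n) φ).comp
      (((AddEquiv.ofBijective h.X hX).symm.toAddMonoidHom).comp
        ((AddMonoidHom.fst _ _).comp (AddMonoidHom.snd _ _)))

theorem linkingEval_apply (φ : E.Θ) (c : B) (y : F.linking n) :
    linkingEval E F n h hX φ c y = (n c).1 y.1.1 +
      tensorEval E F (F.compactIncl.comp n) φ ((AddEquiv.ofBijective h.X hX).symm y.2.1) := rfl

/-- If `χ(ξ ⊕ b) = φ(ξ) + cb`, this map plays the role of `χ ⊗ 1`: it sends the pairing of `x` and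
`f` to `n(χ(x)) f`. It thus recovers the scalar `χ(x)`, acting on `F`, from the paired vector alone.
-/
theorem linkingEval_pair (φ : E.Θ) (c : B) (x : E.linking m) (f : F) :
    linkingEval E F n h hX φ c (linkingPair E F m n h x f)
      = (n (φ.1 x.1.1 + c * x.2.1)).1 f := by
  have : (AddEquiv.ofBijective h.X hX).symm (h.X (tensorMk E F n x.1.1 f))
      = tensorMk E F n x.1.1 f := (AddEquiv.ofBijective h.X hX).symm_apply_apply _
  rw [linkingEval_apply, apply_add, apply_mul, add_comm, ← tensorEval_tensorMk, ← this]
  rfl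

/-- On `n(B)F` the composite is the restriction of `ψ ∘ n(c)`, a functional because compact
operators are adjointable. On `A` it is `φ ⊗ ψ` precomposed with `X⁻¹`, which by compatibility of
`X` and `f` is the functional `f(φ ⊗ ψ)` of `A`. -/
theorem comp_linkingEval_mem (φ : E.Θ) (c : B) (ψ : F.Θ) :
    ψ.1.comp (linkingEval E F n h hX φ c) ∈ (F.linking n).Θ := by
  let χ : (E.tensor F (F.compactIncl.comp n)).Θ :=
    ⟨tensorFunctional E F (F.compactIncl.comp n) φ ψ, AddSubgroup.subset_closure ⟨φ, ψ, rfl⟩⟩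
  let ψ' : F.Θ :=
    ⟨AddMonoidHom.comp ψ.1 (n c).1, (F.compact_le_adjointable (n c).2).2 ψ.1 ψ.2⟩
  refine (congrArg (· ∈ (F.linking n).Θ) (AddMonoidHom.ext fun y => ?_)).mpr
    (F.linkingΘ n (F.restrictΘ n ψ') (h.f χ)).2
  change ψ.1 (linkingEval E F n h hX φ c y) = ψ.1 ((n c).1 y.1.1) + (h.f χ).1 y.2.1
  have : (h.f χ).1 y.2.1 = χ.1 ((AddEquiv.ofBijective h.X hX).symm y.2.1) := by
    rw [← h.compat]
    exact congrArg (h.f χ).1 ((AddEquiv.ofBijective h.X hX).apply_symm_apply y.2.1).symm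
  rw [this, linkingEval_apply, map_add]
  rfl

/-- For `T = θ_{f,ψ}`, right linearity of the pairing in `F` turns the expression into `θ` of the
vector `pair(x, f)` and the functional `ψ ∘ linkingEval`. A compact operator on `F` placed in the
middle therefore yields a compact operator on `n(B)F ⊕ A`. -/
theorem exists_compact_eq_pair (φ : E.Θ) (c : B) (x : E.linking m) {T : AddMonoid.End F.carrier}
    (hT : T ∈ F.compactGroup) : ∃ S ∈ (F.linking n).compactGroup, ∀ y,
      S y = linkingPair E F m n h x (T (linkingEval E F n h hX φ c y)) := by
  refine F.compact_induction (p := fun T => ∃ S ∈ (F.linking n).compactGroup, ∀ y,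
    S y = linkingPair E F m n h x (T (linkingEval E F n h hX φ c y))) (fun f ψ => ?_) ?_ ?_ ?_ hT
  · exact ⟨_, (F.linking n).theta_mem (linkingPair E F m n h x f)
      ⟨_, comp_linkingEval_mem E F n h hX φ c ψ⟩,
      fun y => (linkingPair_rmul E F m n h _ x f).symm⟩
  · exact ⟨0, zero_mem _, fun y => (map_zero (linkingPair E F m n h x)).symm⟩
  · rintro S T ⟨S', hS, hS'⟩ ⟨T', hT, hT'⟩
    refine ⟨S' + T', add_mem hS hT, fun y => ?_⟩
    change S' y + T' y = linkingPair E F m n h x (S _ + T _)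
    rw [hS', hT', map_add]
  · rintro S ⟨S', hS, hS'⟩
    refine ⟨-S', neg_mem hS, fun y => ?_⟩
    change -(S' y) = linkingPair E F m n h x (-(S _))
    rw [hS', map_neg]

/-- For `T = θ_{η,χ}`, balancedness gives `pair(η χ(x), f) = pair(η, n(χ(x)) f)`, and `n(χ(x)) f` is
a value of `linkingEval`. What is missing is a compact operator on `F` in between; cofullness
provides it by writing `η` as a sum of terms `ζ ω(ζ')`, each contributing `n(ω(ζ'))`. -/
theorem linkingPair_lift (hX : Function.Bijective h.X) (hA : A.Quadratik) (hB : B.Quadratik)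
    (T : AddMonoid.End (E.linking m).carrier) (hT : T ∈ (E.linking m).compactGroup) : ∃ T' ∈ (F.linking n).compactGroup, ∀ x f,
      T' (linkingPair E F m n h x f) = linkingPair E F m n h (T x) f := by
  refine (E.linking m).compact_induction (p := fun T => ∃ T' ∈ (F.linking n).compactGroup,
    ∀ x f, T' (linkingPair E F m n h x f) = linkingPair E F m n h (T x) f)
    (fun η χ => ?_) ?_ ?_ ?_ hT
  · obtain ⟨φ, c, hχ⟩ := E.linking_functional m χ
    refine AddSubgroup.closure_induction (p := fun η _ => ∃ T' ∈ (F.linking n).compactGroup,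
      ∀ x f, T' (linkingPair E F m n h x f)
        = linkingPair E F m n h ((E.linking m).rmul (χ.1 x) η) f) ?_ ?_ ?_ ?_
      (E.linking_cofull m hA hB η)
    · rintro _ ⟨ζ, ζ', ω, rfl⟩
      -- The scalar `ω(ζ')` split off from the vector moves across the pairing and becomes the
      -- compact operator `n(ω(ζ'))` on `F`.
      obtain ⟨S, hS, hS'⟩ := exists_compact_eq_pair E F m n h hX φ c ζ (n (ω.1 ζ')).2
      refine ⟨S, hS, fun x f => ?_⟩
      rw [hS', linkingEval_pair, ← hχ, linkingPair_rmul_left, linkingPair_rmul_left]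
    · exact ⟨0, zero_mem _, fun x f => by rw [map_zero, map_zero]; rfl⟩
    · rintro η η' _ _ ⟨S, hS, hS'⟩ ⟨T, hT, hT'⟩
      refine ⟨S + T, add_mem hS hT, fun x f => ?_⟩
      rw [map_add, map_add]
      exact congrArg₂ (· + ·) (hS' x f) (hT' x f)
    · rintro η _ ⟨S, hS, hS'⟩
      refine ⟨-S, neg_mem hS, fun x f => ?_⟩
      rw [map_neg, map_neg]
      exact congrArg Neg.neg (hS' x f)
  · exact ⟨0, zero_mem _, fun x f =>
      (DFunLike.congr_fun (map_zero (linkingPair E F m n h)) f).symm⟩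
  · rintro S T ⟨S', hS, hS'⟩ ⟨T', hT, hT'⟩
    refine ⟨S' + T', add_mem hS hT, fun x f => ?_⟩
    change S' _ + T' _ = linkingPair E F m n h (S x + T x) f
    rw [hS', hT', map_add]; rfl
  · rintro S ⟨S', hS, hS'⟩
    refine ⟨-S', neg_mem hS, fun x f => ?_⟩
    change -(S' _) = linkingPair E F m n h (-(S x)) f
    rw [hS', map_neg]; rfl

/-- The summand `n(B)F` is reached from `0 ⊕ b`. For the summand `A`, each product `a X(ξ ⊗ f)`
equals `X(m(a)ξ ⊗ f)` by left linearity, and `m(a)ξ` lies in the essential part. Such products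
generate `A` because `X` is onto and `A` is quadratik. -/
theorem linkingPair_span (hX : Function.Bijective h.X)
    (hleft : ∀ (a : A) (z : TensorCarrier E F (F.compactIncl.comp n)),
      h.X (tensorLeft E F (F.compactIncl.comp n) (E.compactIncl (m a)) z)
        = (a * h.X z : A.carrier))
    (hA : A.Quadratik) (y : F.linking n) :
    y ∈ AddSubgroup.closure {y | ∃ x f, y = linkingPair E F m n h x f} := by
  refine F.linking_le n (fun b f => ?_) (fun a => ?_) y
  · refine AddSubgroup.subset_closure ⟨E.linkingInr m b, f, F.linking_ext n rfl ?_⟩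
    exact ((congrArg h.X (DFunLike.congr_fun (map_zero (tensorMk E F n)) f)).trans
      (map_zero h.X)).symm
  · refine hA.induction (p := fun a => F.linkingInr n a ∈ _) (fun a c => ?_) ?_ ?_ ?_ a
    · obtain ⟨z, rfl⟩ := hX.2 c
      refine tensor_induction E F n (p := fun z => F.linkingInr n (a * h.X z) ∈ _)
        (fun ξ f => ?_) ?_ (fun z w hz hw => ?_) z
      · refine AddSubgroup.subset_closure
          ⟨E.linkingInl m ⟨_, E.apply_mem_essentialSpan m a ξ⟩, f, F.linking_ext n ?_ ?_⟩
        · exact (F.apply_zero n f).symm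
        · exact (hleft a (tensorMk E F n ξ f)).symm
      · rw [map_zero, mul_zero, map_zero]; exact zero_mem _
      · rw [map_add, mul_add, map_add]; exact add_mem hz hw
    · rw [map_zero]; exact zero_mem _
    · intro x y hx hy
      rw [map_add]; exact add_mem hx hy
    · intro x hx
      rw [map_neg]; exact neg_mem hx

/-! ### The transfer homomorphism interchanges the corners. -/

variable (hleft : ∀ (a : A) (z : TensorCarrier E F (F.compactIncl.comp n)),
  h.X (tensorLeft E F (F.compactIncl.comp n) (E.compactIncl (m a)) z) = (a * h.X z : A.carrier))

/-- The transfer from `m(A) E ⊕ B` to `n(B) F ⊕ A`. -/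
def linkingTransfer (hA : A.Quadratik) (hB : B.Quadratik) :
    Transfer (E.linking m) F (F.linking n) where
  pair := linkingPair E F m n h
  pair_act := linkingPair_act E F m n h
  span := linkingPair_span E F m n h hX hleft hA
  lift := linkingPair_lift E F m n h hX hA hB

/-- The corner operator of `b` turns `ξ ⊕ b'` into `0 ⊕ bb'`, and the pairing turns this into `n(b)
n(b') f ⊕ 0`. -/
theorem linkingTransfer_corner (hA : A.Quadratik) (hB : B.Quadratik) :
    (linkingTransfer E F m n h hX hleft hA hB).hom.comp
      (cornerEmbedding hB (E.essential m) PEmpty.{u + 1} (CopiesAction.empty B))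
      = F.linkingHom n hB :=
  GRingHom.ext fun b => (linkingTransfer E F m n h hX hleft hA hB).op_eq fun x f =>
    F.linking_ext n (F.apply_mul n b x.2.1 f).symm
      ((congrArg h.X (DFunLike.congr_fun (map_zero (tensorMk E F n)) f)).trans (map_zero h.X)).symm

/-- Left `A`-linearity of `E ⊗_n F ≅ A` says precisely that `m(a)` on the first factor becomes
multiplication by `a` on the summand `A`, while the summand `B` is killed. -/
theorem linkingTransfer_linkingHom (hA : A.Quadratik) (hB : B.Quadratik) :
    (linkingTransfer E F m n h hX hleft hA hB).hom.comp (E.linkingHom m hA)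
      = cornerEmbedding hA (F.essential n) PEmpty.{u + 1} (CopiesAction.empty A) :=
  GRingHom.ext fun a => (linkingTransfer E F m n h hX hleft hA hB).op_eq fun x f =>
    F.linking_ext n (F.apply_zero n f).symm (hleft a (tensorMk E F n x.1.1 f)).symm

end FMod

/-! ## The isomorphism in `GK^G` -/

variable {A B : QRing.{u} G}

/-- The morphism `A → 𝒦_B(m(A) E ⊕ B) → B` given by a bimodule. -/
def bimoduleExpr (E : FMod B.ring) (m : GRingHom A.ring E.compactRing) : Expr A B :=
  (Expr.hom (B := QRing.compact _ (E.linking_cofull m A.quadratik B.quadratik))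
    (E.linkingHom m A.quadratik)).comp
    (.gen (.cornerInv B (E.essential m) PEmpty.{u + 1} (CopiesAction.empty B.ring)
      (E.linking_cofull m A.quadratik B.quadratik)))

/-- One of the two tensor product isomorphisms already makes one composite the identity, through the
transfer `τ` between the two linking rings. -/
theorem bimoduleExpr_comp (E : FMod B.ring) (F : FMod A.ring)
    (m : GRingHom A.ring E.compactRing) (n : GRingHom B.ring F.compactRing)
    (h : TensorIsoSelf E F m n) :
    Rel ((bimoduleExpr E m).comp (bimoduleExpr F n)) (Expr.one A) := by
  obtain ⟨h, hiso, hleft⟩ := h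
  have hE := E.linking_cofull m A.quadratik B.quadratik
  have hF := F.linking_cofull n B.quadratik A.quadratik
  let τ := (FMod.linkingTransfer E F m n h hiso.1 hleft A.quadratik B.quadratik).hom
  let τ' : Expr (QRing.compact _ hE) (QRing.compact _ hF) := Expr.hom τ
  let i : Expr A (QRing.compact _ hE) := Expr.hom (E.linkingHom m A.quadratik)
  let j : Expr B (QRing.compact _ hF) := Expr.hom (F.linkingHom n B.quadratik)
  let e : Expr B (QRing.compact _ hE) :=
    Expr.hom (cornerEmbedding B.quadratik (E.essential m) PEmpty (CopiesAction.empty B.ring))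
  let d : Expr A (QRing.compact _ hF) :=
    Expr.hom (cornerEmbedding A.quadratik (F.essential n) PEmpty (CopiesAction.empty A.ring))
  let e' : Expr (QRing.compact _ hE) B := .gen (.cornerInv B (E.essential m) PEmpty _ hE)
  let d' : Expr (QRing.compact _ hF) A := .gen (.cornerInv A (F.essential n) PEmpty _ hF)
  have hj : Rel (e.comp τ') j := by
    have := Rel.hom_comp (A := B) (B := QRing.compact _ hE) (C := QRing.compact _ hF)
      (cornerEmbedding B.quadratik (E.essential m) PEmpty (CopiesAction.empty B.ring)) τ
    rwa [FMod.linkingTransfer_corner] at this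
  have hd : Rel (i.comp τ') d := by
    have := Rel.hom_comp (A := A) (B := QRing.compact _ hE) (C := QRing.compact _ hF)
      (E.linkingHom m A.quadratik) τ
    rwa [FMod.linkingTransfer_linkingHom] at this
  -- As `e'` inverts `e` on both sides, `e τ = j` gives `e' j = e' e τ = τ`; the middle of the
  -- fourfold composite thus becomes a ring homomorphism.
  have hτ : Rel (e'.comp j) τ' :=
    ((Rel.refl e').comp hj.symm).trans <| (Rel.comp_assoc e' e τ').symm.trans <|
      ((Rel.inv_corner B _ _ _ hE).comp (Rel.refl τ')).trans (Rel.one_comp τ')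
  change Rel ((i.comp e').comp (j.comp d')) (Expr.one A)
  refine (Rel.comp_assoc _ _ _).trans ?_
  refine ((Rel.refl i).comp (Rel.comp_assoc e' j d').symm).trans ?_
  refine ((Rel.refl i).comp (hτ.comp (Rel.refl d'))).trans ?_
  refine (Rel.comp_assoc i τ' d').symm.trans ?_
  exact (hd.comp (Rel.refl d')).trans (Rel.corner_inv A _ _ _ hF)

end GKTheory

end

theorem mainTheorem3 {G : Type*} [Group G] (A B : GKTheory.QRing G)
    (h : GKTheory.FunctionalMoritaEquivalent A.ring B.ring) :
    Nonempty (CategoryTheory.Iso (GKTheory.GK.mk A) (GKTheory.GK.mk B)) := by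
  obtain ⟨E, F, m, n, hA, hB⟩ := h
  exact ⟨{
    hom := Quotient.mk _ (GKTheory.bimoduleExpr E m)
    inv := Quotient.mk _ (GKTheory.bimoduleExpr F n)
    hom_inv_id := Quotient.sound (GKTheory.bimoduleExpr_comp E F m n hA)
    -- The second tensor isomorphism is the first with `(A, E, m)` and `(B, F, n)` exchanged.
    inv_hom_id := Quotient.sound (GKTheory.bimoduleExpr_comp F E n m hB) }⟩
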